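/- **Proposition 4.2 (Uniform $L_h^\infty$-bound for the 2D DNLS).** For an integer $M\ge 1$ let $h=\pi/M$ and let $\mathbb{T}_h^2=h\mathbb{Z}^2/2\pi\mathbb{Z}^2$ be the periodic lattice with $(2M)^2$ points. For $f:\mathbb{T}_h^2\to\mathbb{C}$ put $$(\Delta_h f)(x)=\sum_{j=1}^2\frac{f(x+he_j)+f(x-he_j)-2f(x)}{h^2},\qquad (\mathcal{F}_hf)(k)=h^2\sum_{x\in\mathbb{T}_h^2}f(x)e^{-ik\cdot x},$$ $$\|f\|_{L_h^\infty}=\sup_{x\in\mathbb{T}_h^2}|f(x)|,\qquad \|f\|_{H_h^1}=\Big\{\frac1{(2\pi)^2}\sum_{k\in\{-M,\dots,M-1\}^2}(1+|k|^2)\,|(\mathcal{F}_hf)(k)|^2\Big\}^{1/2},$$ and let $\langle T\rangle=\sqrt{1+T^2}$. Suppose that either $\lambda=1$ and $1<p<\infty$, or $\lambda=-1$ and $1<p<3$. Let $q_*=2$ if $1<p<3$, and let $q_*$ be any real number with $q_*>p-1$ if $p\ge3$. Then for every $R\ge 0$ there is a constant $C>0$, depending only on $\lambda,p,q_*$ and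 $R$, such that the following holds for every $M\ge1$ with $h=\pi/M\in(0,1]$. If $u_{h,0}:\mathbb{T}_h^2\to\mathbb{C}$ satisfies $\|u_{h,0}\|_{H_h^1}\le R$, and $u_h:\mathbb{R}\times\mathbb{T}_h^2\to\mathbb{C}$ is the global solution of the discrete nonlinear Schrödinger equation $$i\partial_tu_h+\Delta_hu_h-\lambda|u_h|^{p-1}u_h=0,\qquad u_h(0)=u_{h,0},$$ then $$\Big\{\int_{-T}^{T}\|u_h(t)\|_{L_h^\infty}^{q_*}\,dt\Big\}^{1/q_*}\le C\,\langle T\rangle^{1/q_*}\,\|u_{h,0}\|_{H_h^1}\qquad\text{for all }T>0.$$ In particular $C$ is independent of $h$ and of $T$. -/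

import Mathlib

noncomputable section

namespace DNLS

/-- The mesh size `h = π / M`. -/
def meshSize (M : ℕ) : ℝ := Real.pi / M

/-- The periodic lattice `𝕋_h^d = hℤ^d / 2πℤ^d` with `h = π / M`, a group with `(2M)^d` points.
The class of the point `h (m₁, …, m_d)` is represented by the residues of the integers `m_j`
modulo `2M`. -/
abbrev Lattice (d M : ℕ) : Type := Fin d → ZMod (2 * M)

/-- The real coordinate `x_j ∈ [0, 2π)` of a lattice point. Only its class modulo `2π` matters. -/
def coord {d M : ℕ} (x : Lattice d M) (j : Fin d) : ℝ := meshSize M * ((x j).val : ℝ)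

/-- The discrete Laplacian
`(Δ_h f)(x) = ∑_j (f (x + h e_j) + f (x - h e_j) - 2 f x) / h^2`. -/
def discreteLaplacian {d M : ℕ} (f : Lattice d M → ℂ) (x : Lattice d M) : ℂ :=
  ∑ j : Fin d,
    (f (x + Pi.single j 1) + f (x - Pi.single j 1) - 2 * f x) / ((meshSize M : ℝ) : ℂ) ^ 2

/-- The dual lattice `{-M, …, M - 1}^d` of frequencies. -/
def frequencies (d M : ℕ) : Finset (Fin d → ℤ) :=
  Fintype.piFinset fun _ => Finset.Ico (-(M : ℤ)) (M : ℤ)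

/-- The Fourier transform `(ℱ_h f)(k) = h^d ∑_x f(x) e^{-i k·x}` on the periodic lattice. -/
def fourier {d M : ℕ} [NeZero M] (f : Lattice d M → ℂ) (k : Fin d → ℤ) : ℂ :=
  ((meshSize M : ℝ) : ℂ) ^ d *
    ∑ x : Lattice d M,
      f x * Complex.exp (-Complex.I * ((∑ j : Fin d, (k j : ℝ) * coord x j : ℝ) : ℂ))

/-- The Sobolev norm
`‖f‖_{H_h^s} = ((2π)^{-d} ∑_k ⟨k⟩^{2s} |(ℱ_h f)(k)|^2)^{1/2}`, where `⟨k⟩ = (1 + |k|^2)^{1/2}`. -/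
def sobolevNorm {d M : ℕ} [NeZero M] (s : ℝ) (f : Lattice d M → ℂ) : ℝ :=
  Real.sqrt (((2 * Real.pi) ^ d)⁻¹ *
    ∑ k ∈ frequencies d M, (1 + ∑ j : Fin d, (k j : ℝ) ^ 2) ^ s * ‖fourier f k‖ ^ 2)

/-- The norm `‖f‖_{L_h^∞} = sup_x |f(x)|`. -/
def supNorm {d M : ℕ} (f : Lattice d M → ℂ) : ℝ := ⨆ x : Lattice d M, ‖f x‖

/-- `u` is a global (in time) solution of
`i ∂_t u + Δ_h u - λ |u|^{p-1} u = 0` on the periodic lattice. -/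
def IsSolution {d M : ℕ} (lam p : ℝ) (u : ℝ → Lattice d M → ℂ) : Prop :=
  ∀ (t : ℝ) (x : Lattice d M),
    DifferentiableAt ℝ (fun s => u s x) t ∧
      Complex.I * deriv (fun s => u s x) t + discreteLaplacian (u t) x
        - (lam : ℂ) * ((‖u t x‖ ^ (p - 1) : ℝ) : ℂ) * u t x = 0

/-- The space-time norm `‖u‖_{L_t^q([-T,T]; L_h^∞)}`, with values in `[0, ∞]`. -/
def timeSupNorm {d M : ℕ} (q T : ℝ) (u : ℝ → Lattice d M → ℂ) : ENNReal :=
  MeasureTheory.eLpNorm (fun t : ℝ => supNorm (u t)) (ENNReal.ofReal q)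
    (MeasureTheory.volume.restrict (Set.Icc (-T) T))

/-- The Japanese bracket `⟨T⟩ = (1 + T^2)^{1/2}` of a real number. -/
def bracket (T : ℝ) : ℝ := Real.sqrt (1 + T ^ 2)

end DNLS

end

/-!
The estimate is a Strichartz inequality on the lattice, uniform in the mesh size, combined with the
conservation of mass and energy. Only a small gain over Sobolev embedding is needed, and it is
obtained without oscillatory integrals.

*Dispersion.* In one dimension the exponential sum `S(t, z) = ∑_k z^k e^{-itω(k)}` over
`|k| ≤ N ≤ M` satisfies `|S(t, z)|² ≤ κ(t)` for all `|z| = 1`, with `∫_{-1}^1 κ ≤ C N^{7/4}`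
(`exists_kernel_bound`). Weyl differencing (`norm_sq_sum_le_diffSum`) removes the position `z`. The
second moment in time of the differenced sums counts the near resonances of
`D = (8/h²) sin(hm/2) sin(h(k-k')/2) cos(h(k+k'+m)/2)`, and these are rare, including near the zero
of the cosine, where the lattice dispersion relation degenerates (`sum_near_resonances_le`). In two
dimensions the kernel of a square of frequencies is a product of two such sums, hence at most
`κ(t)`.

*Space-time estimate.* The `T T*` argument (`integral_norm_sq_le_of_kernel`), with a measurable
choice of the maximum point and Schur's test, gives for each dyadic Littlewood-Paley piece of a
solution an `L²([0,1]; L^∞)` bound that gains `2^{-j/4}` over Bernstein's inequality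
(`IsSolution.integral_norm_piece_sq_le`). Interpolating with Bernstein's inequality and summing over
`j` yields, if `‖u(t)‖_{H¹} ≤ A` for all `t`,
`∫_0^1 ‖u‖_∞^q ≤ C A^q (1 + ∫_0^1 ‖u‖_∞^{2p-2})` for every `q ≥ 2` (`exists_integral_rpow_le`).
For `q = 2p` the right side is sublinear in the left side, so that it is absorbed at once, and the
inequality for the given `q` then follows (`exists_integral_rpow_le_of_bound`).

*Uniform `H¹` bound.* Mass and energy are conserved, and a Gagliardo-Nirenberg inequality
(`exists_potential_le`), proved with the same dyadic pieces, gives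
`‖u(t)‖_{H¹} ≤ C(R) ‖u(0)‖_{H¹}` in both cases (`exists_sobolevNorm_le`). Covering `[-T, T]` by unit
intervals gives the factor `⟨T⟩`.
-/

open scoped ComplexConjugate

namespace DNLS

/-! ### Resonances of the one-dimensional lattice dispersion relation -/

/-- The symbol `(2 / h²) (1 - cos (h k))` of the one-dimensional operator `-Δ_h`. -/
noncomputable def symbol (M : ℕ) (k : ℤ) : ℝ :=
  2 / meshSize M ^ 2 * (1 - Real.cos (meshSize M * k))

lemma symbol_resonance (M : ℕ) (k k' m : ℤ) :
    (symbol M (k + m) - symbol M k) - (symbol M (k' + m) - symbol M k') =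
      8 / meshSize M ^ 2 * (Real.sin (meshSize M * m / 2) *
        Real.sin (meshSize M * (k - k' : ℤ) / 2) *
        Real.cos (meshSize M * (k + k' + m : ℤ) / 2)) := by
  set h := meshSize M
  set a : ℝ := h * (k + k' + m : ℤ) / 2 with ha
  set b : ℝ := h * (k - k' : ℤ) / 2 with hb
  set c : ℝ := h * m / 2 with hc
  have e1 : h * ((k + m : ℤ) : ℝ) = a + b + c := by rw [ha, hb, hc]; push_cast; ring
  have e2 : h * (k : ℝ) = a + b - c := by rw [ha, hb, hc]; push_cast; ring
  have e3 : h * ((k' + m : ℤ) : ℝ) = a - b + c := by rw [ha, hb, hc]; push_cast; ring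
  have e4 : h * (k' : ℝ) = a - b - c := by rw [ha, hb, hc]; push_cast; ring
  unfold symbol
  rw [e1, e2, e3, e4]
  simp only [Real.cos_add, Real.cos_sub, Real.sin_add, Real.sin_sub]
  ring

lemma abs_resonance_ge {M N : ℕ} (hM : 0 < M) (hNM : N ≤ M) {k k' m : ℤ}
    (hm : |m| ≤ N) (hl : |k - k'| ≤ N) (hs0 : 0 ≤ k + k' + m) (hs1 : k + k' + m ≤ 2 * N) :
    1 / 2 * (|(m : ℝ)| * |((k - k' : ℤ) : ℝ)| * |1 - ((k + k' + m : ℤ) : ℝ) / M|) ≤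
      |(symbol M (k + m) - symbol M k) - (symbol M (k' + m) - symbol M k')| := by
  have hM' : (0 : ℝ) < M := by exact_mod_cast hM
  have hN' : (N : ℝ) ≤ M := by exact_mod_cast hNM
  have hh : meshSize M * M = Real.pi := by unfold meshSize; field_simp
  have hpos : 0 < meshSize M := div_pos Real.pi_pos hM'
  have jordan : ∀ y : ℝ, |y| ≤ M → meshSize M / Real.pi * |y| ≤ |Real.sin (meshSize M * y / 2)| := by
    intro y hy
    have h1 : |meshSize M * y / 2| = meshSize M * |y| / 2 := by
      rw [abs_div, abs_mul, abs_of_pos hpos, abs_of_pos (two_pos : (0 : ℝ) < 2)]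
    have := Real.mul_abs_le_abs_sin (x := meshSize M * y / 2) (by rw [h1]; nlinarith)
    rw [h1] at this
    calc _ = 2 / Real.pi * (meshSize M * |y| / 2) := by ring
      _ ≤ _ := this
  rw [symbol_resonance]
  have hm' : |(m : ℝ)| ≤ M := by
    have : (|m| : ℤ) ≤ (M : ℤ) := by omega
    exact_mod_cast this
  have hl' : |((k - k' : ℤ) : ℝ)| ≤ M := by
    have : (|k - k'| : ℤ) ≤ (M : ℤ) := by omega
    exact_mod_cast this
  have hs' : |(M : ℝ) - ((k + k' + m : ℤ) : ℝ)| ≤ M := by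
    have : |(M : ℤ) - (k + k' + m)| ≤ (M : ℤ) := by rw [abs_le]; constructor <;> omega
    exact_mod_cast this
  have h1 := jordan _ hm'
  have h2 := jordan _ hl'
  have h3 := jordan _ hs'
  have e : meshSize M * ((M : ℝ) - ((k + k' + m : ℤ) : ℝ)) / 2
      = Real.pi / 2 - meshSize M * ((k + k' + m : ℤ) : ℝ) / 2 := by
    rw [← hh]; ring
  rw [e, Real.sin_pi_div_two_sub] at h3
  have h4 : |1 - ((k + k' + m : ℤ) : ℝ) / M| = |(M : ℝ) - ((k + k' + m : ℤ) : ℝ)| / M := by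
    rw [← abs_of_pos hM', ← abs_div, abs_of_pos hM']; congr 1; field_simp
  rw [h4, abs_mul, abs_mul, abs_mul, abs_of_pos (by positivity : 0 < 8 / meshSize M ^ 2)]
  have key : 8 / meshSize M ^ 2 * (meshSize M / Real.pi * |(m : ℝ)| *
      (meshSize M / Real.pi * |((k - k' : ℤ) : ℝ)|) *
      (meshSize M / Real.pi * |(M : ℝ) - ((k + k' + m : ℤ) : ℝ)|)) ≤ _ :=
    mul_le_mul_of_nonneg_left (mul_le_mul (mul_le_mul h1 h2 (by positivity) (by positivity)) h3
      (by positivity) (by positivity)) (by positivity)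
  refine le_trans ?_ key
  have hpi : Real.pi ^ 2 ≤ 16 := by nlinarith [Real.pi_le_four, Real.pi_pos]
  have : 8 / meshSize M ^ 2 * (meshSize M / Real.pi * |(m : ℝ)| *
      (meshSize M / Real.pi * |((k - k' : ℤ) : ℝ)|) *
      (meshSize M / Real.pi * |(M : ℝ) - ((k + k' + m : ℤ) : ℝ)|)) =
      8 / Real.pi ^ 2 * (|(m : ℝ)| * |((k - k' : ℤ) : ℝ)| *
        (|(M : ℝ) - ((k + k' + m : ℤ) : ℝ)| / M)) := by
    have : meshSize M = Real.pi / M := rfl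
    rw [this]; field_simp
  rw [this]
  refine mul_le_mul_of_nonneg_right ?_ (by positivity)
  rw [div_le_div_iff₀ (by norm_num) (by positivity)]
  linarith

lemma card_le_of_abs_sub_lt (S : Finset ℤ) (c r : ℝ) (hr : 0 ≤ r)
    (hS : ∀ n ∈ S, |(n : ℝ) - c| < r) : (S.card : ℝ) ≤ 2 * r + 1 := by
  have hsub : S ⊆ Finset.Icc ⌈c - r⌉ ⌊c + r⌋ := by
    intro n hn
    have := abs_lt.1 (hS n hn)
    rw [Finset.mem_Icc]
    exact ⟨Int.ceil_le.2 (by linarith), Int.le_floor.2 (by linarith)⟩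
  have h1 : (S.card : ℝ) ≤ ((⌊c + r⌋ + 1 - ⌈c - r⌉).toNat : ℝ) := by
    have := Finset.card_le_card hsub
    rw [Int.card_Icc] at this
    exact_mod_cast this
  refine h1.trans ?_
  rcases le_total 0 (⌊c + r⌋ + 1 - ⌈c - r⌉) with h | h
  · have h2 : ((⌊c + r⌋ + 1 - ⌈c - r⌉).toNat : ℝ) = ((⌊c + r⌋ + 1 - ⌈c - r⌉ : ℤ) : ℝ) := by
      exact_mod_cast Int.toNat_of_nonneg h
    rw [h2]; push_cast
    linarith [Int.floor_le (c + r), Int.le_ceil (c - r)]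
  · rw [Int.toNat_of_nonpos h]; push_cast; linarith

/-- Away from `s = M` the cosine factor of the resonance function is not small: at most
`O(√N)` integers `s ∈ [0, 2N]` have `|1 - s/M| < N^{-1/2}`, uniformly in `M`. -/
lemma card_near_le {M N : ℕ} (hM : 0 < M) {c : ℝ} (hc : 1 ≤ c) (hN : (N : ℝ) ≤ c ^ 4)
    (S : Finset ℤ) (hS : ∀ s ∈ S, 0 ≤ s ∧ s ≤ 2 * N ∧ |1 - (s : ℝ) / M| < 1 / c ^ 2) :
    (S.card : ℝ) ≤ 10 * c ^ 2 := by
  have hM' : (0 : ℝ) < M := by exact_mod_cast hM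
  have hc2 : 1 ≤ c ^ 2 := one_le_pow₀ hc
  have hcc : c ^ 4 = c ^ 2 * c ^ 2 := by ring
  rcases lt_or_ge (c ^ 2) 2 with hb | hb
  · have h1 := card_le_of_abs_sub_lt S N (N + 1 / 2) (by positivity) (by
      intro s hs
      obtain ⟨h0, h1, -⟩ := hS s hs
      have h0' : (0 : ℝ) ≤ s := by exact_mod_cast h0
      have h1' : (s : ℝ) ≤ 2 * N := by exact_mod_cast h1
      rw [abs_lt]; constructor <;> linarith)
    nlinarith
  · refine (card_le_of_abs_sub_lt S M (4 * c ^ 2) (by positivity) ?_).trans (by linarith)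
    intro s hs
    obtain ⟨h0, h1, h2⟩ := hS s hs
    have h1' : (s : ℝ) ≤ 2 * N := by exact_mod_cast h1
    have e : |1 - (s : ℝ) / M| = |(s : ℝ) - M| / M := by
      rw [abs_sub_comm, ← abs_of_pos hM', ← abs_div, abs_of_pos hM']; congr 1; field_simp
    rw [e, div_lt_div_iff₀ hM' (by positivity), one_mul] at h2
    have h3 : |(s : ℝ) - M| * 2 ≤ |(s : ℝ) - M| * c ^ 2 :=
      mul_le_mul_of_nonneg_left hb (abs_nonneg _)
    have h4 : (M : ℝ) < 4 * N := by linarith [neg_abs_le ((s : ℝ) - M)]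
    have h5 : |(s : ℝ) - M| * c ^ 2 < 4 * c ^ 2 * c ^ 2 := by nlinarith
    exact lt_of_mul_lt_mul_right h5 (by positivity)

/-! ### The exponential sum estimate -/

lemma norm_integral_exp_le {D δ : ℝ} (hδ : 0 < δ) :
    ‖∫ t in (-1 : ℝ)..1, Complex.exp (-(t * D) * Complex.I)‖ ≤
      (if |D| < δ then 2 else 0) + 2 / δ := by
  split_ifs with h
  · have : ‖∫ t in (-1 : ℝ)..1, Complex.exp (-(t * D) * Complex.I)‖ ≤ 1 * |(1 : ℝ) - (-1)| := by
      refine intervalIntegral.norm_integral_le_of_norm_le_const fun t _ => ?_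
      have := Complex.norm_exp_ofReal_mul_I (-(t * D))
      push_cast at this
      exact this.le
    have h2 : 0 < 2 / δ := by positivity
    rw [one_mul, show |(1 : ℝ) - (-1)| = 2 by norm_num] at this
    linarith
  · push Not at h
    have hD : 0 < |D| := hδ.trans_le h
    have hD0 : D ≠ 0 := abs_pos.1 hD
    have hc : (-(D : ℂ) * Complex.I) ≠ 0 := by simp [hD0]
    have : (fun t : ℝ => Complex.exp (-(t * D) * Complex.I)) =
        fun t : ℝ => Complex.exp ((-(D : ℂ) * Complex.I) * t) := by
      funext t; congr 1; ring
    rw [this, integral_exp_mul_complex hc, norm_div, zero_add]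
    have e1 : ‖-(D : ℂ) * Complex.I‖ = |D| := by simp
    rw [e1]
    have n : ∀ y : ℝ, ‖Complex.exp (-(D : ℂ) * Complex.I * (y : ℝ))‖ = 1 := by
      intro y
      have := Complex.norm_exp_ofReal_mul_I (-(D * y))
      rw [← this]; congr 2; push_cast; ring
    calc _ ≤ (1 + 1) / |D| := by
          gcongr
          refine (norm_sub_le _ _).trans ?_
          rw [n, n]
      _ ≤ 2 / δ := by rw [one_add_one_eq_two]; gcongr

/-- The second moment in time of an exponential sum is controlled by the number of pairs of
frequencies at distance less than `δ`. -/
lemma integral_normSq_sum_le {ι : Type*} (S : Finset ι) (Om : ι → ℝ) {δ : ℝ} (hδ : 0 < δ) :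
    ∫ t in (-1 : ℝ)..1, ‖∑ k ∈ S, Complex.exp (-(t * Om k) * Complex.I)‖ ^ 2 ≤
      ∑ k ∈ S, ∑ k' ∈ S, ((if |Om k - Om k'| < δ then 2 else 0) + 2 / δ) := by
  have e : ∀ t : ℝ, ((‖∑ k ∈ S, Complex.exp (-(t * Om k) * Complex.I)‖ ^ 2 : ℝ) : ℂ) =
      ∑ k ∈ S, ∑ k' ∈ S, Complex.exp (-(t * (Om k - Om k' : ℝ)) * Complex.I) := by
    intro t
    rw [← Complex.normSq_eq_norm_sq, ← Complex.mul_conj, map_sum, Finset.sum_mul_sum]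
    refine Finset.sum_congr rfl fun k _ => Finset.sum_congr rfl fun k' _ => ?_
    rw [← Complex.exp_conj, ← Complex.exp_add]
    congr 1
    simp
    ring
  have h : ((∫ t in (-1 : ℝ)..1, ‖∑ k ∈ S, Complex.exp (-(t * Om k) * Complex.I)‖ ^ 2 : ℝ) : ℂ) =
      ∑ k ∈ S, ∑ k' ∈ S, ∫ t in (-1 : ℝ)..1,
        Complex.exp (-(t * (Om k - Om k' : ℝ)) * Complex.I) := by
    rw [← intervalIntegral.integral_ofReal]
    simp_rw [e]
    rw [intervalIntegral.integral_finsetSum]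
    · refine Finset.sum_congr rfl fun k _ => ?_
      rw [intervalIntegral.integral_finsetSum]
      intro k' _
      exact Continuous.intervalIntegrable (by fun_prop) _ _
    · intro k _
      exact Continuous.intervalIntegrable (by fun_prop) _ _
  refine (le_abs_self _).trans ?_
  rw [← Real.norm_eq_abs, ← Complex.norm_real, h]
  refine (norm_sum_le _ _).trans (Finset.sum_le_sum fun k _ => (norm_sum_le _ _).trans
    (Finset.sum_le_sum fun k' _ => norm_integral_exp_le hδ))

/-- The differenced exponential sum `∑_k e^{-it(ω(k+m) - ω(k))}` over `k, k + m ∈ J`. -/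
noncomputable def diffSum (M : ℕ) (J : Finset ℤ) (m : ℤ) (t : ℝ) : ℂ :=
  ∑ k ∈ J.filter (fun k => k + m ∈ J),
    Complex.exp (-(t * (symbol M (k + m) - symbol M k : ℝ)) * Complex.I)

lemma continuous_diffSum (M : ℕ) (J : Finset ℤ) (m : ℤ) : Continuous (diffSum M J m) := by
  unfold diffSum; fun_prop

/-- Weyl differencing removes the position `z` from the exponential sum. -/
lemma norm_sq_sum_le_diffSum (M : ℕ) {N : ℕ} {J : Finset ℤ} (hJ : ∀ k ∈ J, 0 ≤ k ∧ k ≤ N)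
    (t : ℝ) (z : ℂ) (hz : ‖z‖ = 1) :
    ‖∑ k ∈ J, z ^ k * Complex.exp (-(t * symbol M k) * Complex.I)‖ ^ 2 ≤
      ∑ m ∈ Finset.Icc (-(N : ℤ)) N, ‖diffSum M J m t‖ := by
  have hz0 : z ≠ 0 := by intro h; simp [h] at hz
  have key : ((‖∑ k ∈ J, z ^ k * Complex.exp (-(t * symbol M k) * Complex.I)‖ ^ 2 : ℝ) : ℂ) =
      ∑ m ∈ Finset.Icc (-(N : ℤ)) N, z ^ m * diffSum M J m t := by
    rw [← Complex.normSq_eq_norm_sq, ← Complex.mul_conj, map_sum, Finset.sum_mul_sum,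
      Finset.sum_comm]
    unfold diffSum
    simp_rw [Finset.mul_sum, Finset.sum_filter]
    rw [Finset.sum_comm (s := Finset.Icc (-(N : ℤ)) N)]
    refine Finset.sum_congr rfl fun k hk => ?_
    rw [← Finset.sum_filter]
    refine Finset.sum_bij' (fun l _ => l - k) (fun m _ => k + m) ?_ ?_ ?_ ?_ ?_
    · intro l hl
      have h1 := hJ k hk
      have h2 := hJ l hl
      simp only [Finset.mem_filter, Finset.mem_Icc]
      refine ⟨⟨by omega, by omega⟩, ?_⟩
      simpa using hl
    · intro m hm
      exact (Finset.mem_filter.1 hm).2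
    · intro l _; ring
    · intro m _; ring
    · intro l _
      have hconj : (starRingEnd ℂ) z = z⁻¹ := by
        rw [Complex.inv_def, Complex.normSq_eq_norm_sq, hz]; simp
      have : k + (l - k) = l := by ring
      rw [this, map_mul, ← Complex.exp_conj, map_zpow₀, hconj, zpow_sub₀ hz0]
      have : Complex.exp (-(t * symbol M l) * Complex.I) *
          Complex.exp ((starRingEnd ℂ) (-(t * symbol M k) * Complex.I)) =
          Complex.exp (-(t * (symbol M l - symbol M k : ℝ)) * Complex.I) := by
        rw [← Complex.exp_add]; congr 1; simp; ring
      rw [← this]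
      simp only [inv_zpow', zpow_neg]
      field_simp
  refine (le_abs_self _).trans ?_
  rw [← Real.norm_eq_abs, ← Complex.norm_real, key]
  refine (norm_sum_le _ _).trans (Finset.sum_le_sum fun m _ => ?_)
  rw [norm_mul, norm_zpow, hz, one_zpow, one_mul]

/-- Counting near resonances. Outside the `O(c¹⁰)` triples with `|m| < c²`, `|k - k'| < c²` or
`|1 - s/M| < c⁻²`, where `s = k + k' + m`, the resonance function is at least `c²/2`; for `c⁴ = N`
the total is `O(N^{5/2})`, out of about `N³` triples. -/
lemma sum_near_resonances_le {M N : ℕ} (hM : 0 < M) (hNM : N ≤ M) {c : ℝ}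
    (hc : 1 ≤ c) (hN : (N : ℝ) ≤ c ^ 4) {J : Finset ℤ} (hJ : ∀ k ∈ J, 0 ≤ k ∧ k ≤ N) :
    ∑ m ∈ Finset.Icc (-(N : ℤ)) N, ∑ k ∈ J.filter (fun k => k + m ∈ J),
      ∑ k' ∈ J.filter (fun k => k + m ∈ J),
        ((if |(symbol M (k + m) - symbol M k) - (symbol M (k' + m) - symbol M k')| < c ^ 2 / 2
          then (2 : ℝ) else 0) + 2 / (c ^ 2 / 2)) ≤ 200 * c ^ 10 := by
  have hc2 : 1 ≤ c ^ 2 := one_le_pow₀ hc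
  have hc4 : 1 ≤ c ^ 4 := one_le_pow₀ hc
  have hc0 : 0 < c ^ 2 := by positivity
  set I : Finset ℤ := Finset.Icc 0 (N : ℤ) with hI
  set G : Finset ℤ := Finset.Icc (-(N : ℤ)) N with hG
  have cardI : (I.card : ℝ) ≤ 2 * c ^ 4 := by
    have : I.card = N + 1 := by rw [hI, Int.card_Icc]; omega
    rw [this]; push_cast; linarith
  have cardG : (G.card : ℝ) ≤ 3 * c ^ 4 := by
    have : G.card = 2 * N + 1 := by rw [hG, Int.card_Icc]; omega
    rw [this]; push_cast; linarith
  let P3 : ℤ → Prop := fun s => 0 ≤ s ∧ s ≤ 2 * N ∧ |1 - (s : ℝ) / M| < 1 / c ^ 2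
  classical
  have pt : ∀ m ∈ G, ∀ k ∈ J.filter (fun k => k + m ∈ J), ∀ k' ∈ J.filter (fun k => k + m ∈ J),
      (if |(symbol M (k + m) - symbol M k) - (symbol M (k' + m) - symbol M k')| < c ^ 2 / 2
          then (2 : ℝ) else 0) + 2 / (c ^ 2 / 2) ≤
      2 * ((if |(m : ℝ) - 0| < c ^ 2 then 1 else 0) +
        (if |(k' : ℝ) - k| < c ^ 2 then 1 else 0) + (if P3 (k + k' + m) then 1 else 0))
        + 4 / c ^ 2 := by
    intro m hm k hk k' hk'
    obtain ⟨hk1, hk2⟩ := Finset.mem_filter.1 hk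
    obtain ⟨hk1', hk2'⟩ := Finset.mem_filter.1 hk'
    have a1 := hJ _ hk1
    have a2 := hJ _ hk2
    have a3 := hJ _ hk1'
    have a4 := hJ _ hk2'
    have hm' := Finset.mem_Icc.1 hm
    have e : 2 / (c ^ 2 / 2) = 4 / c ^ 2 := by field_simp; norm_num
    rw [e]
    gcongr ?_ + _
    by_cases hnear : |(m : ℝ) - 0| < c ^ 2 ∨ |(k' : ℝ) - k| < c ^ 2 ∨ P3 (k + k' + m)
    · have : (1 : ℝ) ≤ (if |(m : ℝ) - 0| < c ^ 2 then 1 else 0) +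
        (if |(k' : ℝ) - k| < c ^ 2 then 1 else 0) + (if P3 (k + k' + m) then 1 else 0) := by
        rcases hnear with h | h | h
        all_goals
          rw [if_pos h]
          have : ∀ (Q : Prop) [Decidable Q], (0 : ℝ) ≤ if Q then 1 else 0 := by
            intro Q _; split_ifs <;> norm_num
          first
            | linarith [this (|(k' : ℝ) - k| < c ^ 2), this (P3 (k + k' + m))]
            | linarith [this (|(m : ℝ) - 0| < c ^ 2), this (P3 (k + k' + m))]
            | linarith [this (|(m : ℝ) - 0| < c ^ 2), this (|(k' : ℝ) - k| < c ^ 2)]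
      split_ifs at this ⊢ <;> linarith
    · push Not at hnear
      obtain ⟨h1, h2, h3⟩ := hnear
      have h3' : 1 / c ^ 2 ≤ |1 - ((k + k' + m : ℤ) : ℝ) / M| := by
        by_contra hlt
        exact h3 ⟨by omega, by omega, not_le.1 hlt⟩
      have h4 := abs_resonance_ge hM hNM (k := k) (k' := k') (m := m) (abs_le.2 ⟨hm'.1, hm'.2⟩)
        (abs_le.2 ⟨by omega, by omega⟩) (by omega) (by omega)
      rw [sub_zero] at h1
      rw [abs_sub_comm] at h2
      have h5 : c ^ 2 * c ^ 2 * (1 / c ^ 2) ≤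
          |(m : ℝ)| * |((k - k' : ℤ) : ℝ)| * |1 - ((k + k' + m : ℤ) : ℝ) / M| := by
        push_cast at h3' ⊢
        gcongr
      have h6 : c ^ 2 * c ^ 2 * (1 / c ^ 2) = c ^ 2 := by field_simp
      rw [if_neg (by rw [not_lt]; linarith)]
      split_ifs <;> norm_num
  have nn : ∀ (m k k' : ℤ), (0 : ℝ) ≤ 2 * ((if |(m : ℝ) - 0| < c ^ 2 then 1 else 0) +
        (if |(k' : ℝ) - k| < c ^ 2 then 1 else 0) + (if P3 (k + k' + m) then 1 else 0))
        + 4 / c ^ 2 := by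
    intro m k k'
    have : (0 : ℝ) ≤ 4 / c ^ 2 := by positivity
    split_ifs <;> linarith
  have sub : ∀ m, J.filter (fun k => k + m ∈ J) ⊆ I := by
    intro m k hk
    have := hJ _ (Finset.mem_filter.1 hk).1
    exact Finset.mem_Icc.2 this
  have step1 : ∑ m ∈ G, ∑ k ∈ J.filter (fun k => k + m ∈ J),
      ∑ k' ∈ J.filter (fun k => k + m ∈ J),
        ((if |(symbol M (k + m) - symbol M k) - (symbol M (k' + m) - symbol M k')| < c ^ 2 / 2
          then (2 : ℝ) else 0) + 2 / (c ^ 2 / 2)) ≤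
      ∑ m ∈ G, ∑ k ∈ I, ∑ k' ∈ I, (2 * ((if |(m : ℝ) - 0| < c ^ 2 then 1 else 0) +
        (if |(k' : ℝ) - k| < c ^ 2 then 1 else 0) + (if P3 (k + k' + m) then 1 else 0))
        + 4 / c ^ 2) := by
    refine Finset.sum_le_sum fun m hm => ?_
    refine (Finset.sum_le_sum fun k hk => (Finset.sum_le_sum fun k' hk' => pt m hm k hk k' hk').trans
      (Finset.sum_le_sum_of_subset_of_nonneg (sub m) fun k' _ _ => nn m k k')).trans
      (Finset.sum_le_sum_of_subset_of_nonneg (sub m) fun k _ _ =>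
        Finset.sum_nonneg fun k' _ => nn m k k')
  refine step1.trans ?_
  have s1 : ∑ m ∈ G, ∑ k ∈ I, ∑ k' ∈ I, (if |(m : ℝ) - 0| < c ^ 2 then (1 : ℝ) else 0) ≤
      3 * c ^ 2 * (2 * c ^ 4) * (2 * c ^ 4) := by
    have : (((G.filter fun m : ℤ => |(m : ℝ) - 0| < c ^ 2).card : ℕ) : ℝ) ≤ 3 * c ^ 2 := by
      refine (card_le_of_abs_sub_lt _ 0 (c ^ 2) hc0.le ?_).trans (by linarith)
      intro n hn; exact (Finset.mem_filter.1 hn).2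
    simp only [Finset.sum_const, nsmul_eq_mul]
    rw [← Finset.mul_sum, ← Finset.mul_sum, Finset.sum_boole]
    calc _ = (((G.filter fun m : ℤ => |(m : ℝ) - 0| < c ^ 2).card : ℕ) : ℝ) * I.card * I.card := by
          ring
      _ ≤ _ := by gcongr
  have s2 : ∑ m ∈ G, ∑ k ∈ I, ∑ k' ∈ I, (if |(k' : ℝ) - k| < c ^ 2 then (1 : ℝ) else 0) ≤
      3 * c ^ 4 * (2 * c ^ 4 * (3 * c ^ 2)) := by
    have : ∀ k ∈ I, ∑ k' ∈ I, (if |(k' : ℝ) - k| < c ^ 2 then (1 : ℝ) else 0) ≤ 3 * c ^ 2 := by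
      intro k _
      rw [Finset.sum_boole]
      refine (card_le_of_abs_sub_lt _ k (c ^ 2) hc0.le ?_).trans (by linarith)
      intro n hn; exact (Finset.mem_filter.1 hn).2
    have := Finset.sum_le_sum this
    rw [Finset.sum_const, nsmul_eq_mul] at this
    rw [Finset.sum_const, nsmul_eq_mul]
    gcongr
    exact this.trans (by gcongr)
  have s3 : ∑ m ∈ G, ∑ k ∈ I, ∑ k' ∈ I, (if P3 (k + k' + m) then (1 : ℝ) else 0) ≤
      2 * c ^ 4 * (2 * c ^ 4 * (10 * c ^ 2)) := by
    rw [Finset.sum_comm]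
    have : ∀ k ∈ I, ∑ m ∈ G, ∑ k' ∈ I, (if P3 (k + k' + m) then (1 : ℝ) else 0) ≤
        2 * c ^ 4 * (10 * c ^ 2) := by
      intro k _
      rw [Finset.sum_comm]
      have : ∀ k' ∈ I, ∑ m ∈ G, (if P3 (k + k' + m) then (1 : ℝ) else 0) ≤ 10 * c ^ 2 := by
        intro k' _
        rw [Finset.sum_boole]
        have hinj : Function.Injective fun m : ℤ => k + k' + m := add_right_injective _
        rw [← Finset.card_image_of_injective _ hinj]
        refine card_near_le hM hc hN _ ?_
        intro s hs
        obtain ⟨m, hm, rfl⟩ := Finset.mem_image.1 hs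
        exact (Finset.mem_filter.1 hm).2
      have := Finset.sum_le_sum this
      rw [Finset.sum_const, nsmul_eq_mul] at this
      exact this.trans (by gcongr)
    have := Finset.sum_le_sum this
    rw [Finset.sum_const, nsmul_eq_mul] at this
    exact this.trans (by gcongr)
  have s4 : ∑ m ∈ G, ∑ k ∈ I, ∑ k' ∈ I, 4 / c ^ 2 ≤ 48 * c ^ 10 := by
    simp only [Finset.sum_const, nsmul_eq_mul]
    calc _ ≤ (3 * c ^ 4) * ((2 * c ^ 4) * ((2 * c ^ 4) * (4 / c ^ 2))) := by gcongr
      _ = _ := by field_simp; norm_num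
  simp only [Finset.sum_add_distrib, ← Finset.mul_sum]
  have r1 : 3 * c ^ 2 * (2 * c ^ 4) * (2 * c ^ 4) = 12 * c ^ 10 := by ring
  have r2 : 3 * c ^ 4 * (2 * c ^ 4 * (3 * c ^ 2)) = 18 * c ^ 10 := by ring
  have r3 : 2 * c ^ 4 * (2 * c ^ 4 * (10 * c ^ 2)) = 40 * c ^ 10 := by ring
  rw [r1] at s1
  rw [r2] at s2
  rw [r3] at s3
  have : 0 < c ^ 10 := by positivity
  linarith

/-- The second moments bound the first: `‖T_m‖ ≤ (c³ + ‖T_m‖² / c³) / 2`, where `c³` balances the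
two contributions `c⁴ · c³` and `c¹⁰ / c³`. -/
lemma sum_integral_diffSum_le {M N : ℕ} (hM : 0 < M) (hNM : N ≤ M) {c : ℝ}
    (hc : 1 ≤ c) (hN : (N : ℝ) ≤ c ^ 4) {J : Finset ℤ} (hJ : ∀ k ∈ J, 0 ≤ k ∧ k ≤ N) :
    ∫ t in (-1 : ℝ)..1, ∑ m ∈ Finset.Icc (-(N : ℤ)) N, ‖diffSum M J m t‖ ≤ 103 * c ^ 7 := by
  have hc0 : 0 < c := by linarith
  have hc4 : 1 ≤ c ^ 4 := one_le_pow₀ hc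
  have cont := continuous_diffSum M J
  rw [intervalIntegral.integral_finsetSum
    (fun m _ => (cont m).norm.intervalIntegrable _ _)]
  have h1 : ∀ m, ∫ t in (-1 : ℝ)..1, ‖diffSum M J m t‖ ≤
      c ^ 3 + (∫ t in (-1 : ℝ)..1, ‖diffSum M J m t‖ ^ 2) / (2 * c ^ 3) := by
    intro m
    have hi : IntervalIntegrable (fun t => ‖diffSum M J m t‖ ^ 2 / (2 * c ^ 3))
        MeasureTheory.volume (-1) 1 :=
      ((cont m).norm.pow 2).div_const _ |>.intervalIntegrable _ _
    have : c ^ 3 + (∫ t in (-1 : ℝ)..1, ‖diffSum M J m t‖ ^ 2) / (2 * c ^ 3) =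
        ∫ t in (-1 : ℝ)..1, (c ^ 3 / 2 + ‖diffSum M J m t‖ ^ 2 / (2 * c ^ 3)) := by
      rw [intervalIntegral.integral_add (by simp) hi, intervalIntegral.integral_div]
      simp; ring
    rw [this]
    refine intervalIntegral.integral_mono_on (by norm_num)
      ((cont m).norm.intervalIntegrable _ _) ((by simp : IntervalIntegrable _ _ _ _).add hi) ?_
    intro t _
    have := sq_nonneg (‖diffSum M J m t‖ - c ^ 3)
    have e : c ^ 3 / 2 + ‖diffSum M J m t‖ ^ 2 / (2 * c ^ 3) - ‖diffSum M J m t‖ =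
      (‖diffSum M J m t‖ - c ^ 3) ^ 2 / (2 * c ^ 3) := by field_simp; ring
    have : 0 ≤ (‖diffSum M J m t‖ - c ^ 3) ^ 2 / (2 * c ^ 3) := by positivity
    linarith
  refine (Finset.sum_le_sum fun m _ => h1 m).trans ?_
  rw [Finset.sum_add_distrib, ← Finset.sum_div, Finset.sum_const, nsmul_eq_mul]
  have h2 : ∑ m ∈ Finset.Icc (-(N : ℤ)) N, ∫ t in (-1 : ℝ)..1, ‖diffSum M J m t‖ ^ 2 ≤
      200 * c ^ 10 := by
    refine le_trans (Finset.sum_le_sum fun m _ => ?_)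
      (sum_near_resonances_le hM hNM hc hN hJ)
    exact integral_normSq_sum_le _ (fun k => symbol M (k + m) - symbol M k) (by positivity)
  have h3 : (((Finset.Icc (-(N : ℤ)) N).card : ℕ) : ℝ) ≤ 3 * c ^ 4 := by
    have : (Finset.Icc (-(N : ℤ)) N).card = 2 * N + 1 := by rw [Int.card_Icc]; omega
    rw [this]; push_cast; linarith
  calc _ ≤ 3 * c ^ 4 * c ^ 3 + 200 * c ^ 10 / (2 * c ^ 3) := by gcongr
    _ = 103 * c ^ 7 := by field_simp; ring

/-- One-dimensional dispersive estimate: frequencies in `[-N, N]`, with `N ≤ M` and `N ≤ c⁴`. The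
gain over the trivial bound `N²` of the time integral is a factor `N^{-1/4}`. -/
lemma exists_kernel_bound {M N : ℕ} (hM : 0 < M) (hNM : N ≤ M) {c : ℝ}
    (hc : 1 ≤ c) (hN : (N : ℝ) ≤ c ^ 4) {J : Finset ℤ} (hJ : ∀ k ∈ J, |k| ≤ N) :
    ∃ κ : ℝ → ℝ, Continuous κ ∧ (∫ t in (-1 : ℝ)..1, κ t) ≤ 412 * c ^ 7 ∧
      ∀ (t : ℝ) (z : ℂ), ‖z‖ = 1 →
        ‖∑ k ∈ J, z ^ k * Complex.exp (-(t * symbol M k) * Complex.I)‖ ^ 2 ≤ κ t := by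
  set Jp := J.filter (fun k => 0 ≤ k)
  set Jm := (J.filter (fun k => ¬ 0 ≤ k)).image (fun k => -k)
  have hJp : ∀ k ∈ Jp, 0 ≤ k ∧ k ≤ N := by
    intro k hk
    obtain ⟨h1, h2⟩ := Finset.mem_filter.1 hk
    exact ⟨h2, (abs_le.1 (hJ k h1)).2⟩
  have hJm : ∀ k ∈ Jm, 0 ≤ k ∧ k ≤ N := by
    intro k hk
    obtain ⟨l, hl, rfl⟩ := Finset.mem_image.1 hk
    obtain ⟨h1, h2⟩ := Finset.mem_filter.1 hl
    have := (abs_le.1 (hJ l h1)).1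
    constructor <;> omega
  have cp : Continuous fun t => ∑ m ∈ Finset.Icc (-(N : ℤ)) N, ‖diffSum M Jp m t‖ :=
    continuous_finsetSum _ fun m _ => (continuous_diffSum M Jp m).norm
  have cm : Continuous fun t => ∑ m ∈ Finset.Icc (-(N : ℤ)) N, ‖diffSum M Jm m t‖ :=
    continuous_finsetSum _ fun m _ => (continuous_diffSum M Jm m).norm
  refine ⟨fun t => 2 * (∑ m ∈ Finset.Icc (-(N : ℤ)) N, ‖diffSum M Jp m t‖) +
    2 * ∑ m ∈ Finset.Icc (-(N : ℤ)) N, ‖diffSum M Jm m t‖, by fun_prop, ?_, ?_⟩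
  · rw [intervalIntegral.integral_add ((cp.const_mul 2).intervalIntegrable _ _)
      ((cm.const_mul 2).intervalIntegrable _ _), intervalIntegral.integral_const_mul,
      intervalIntegral.integral_const_mul]
    linarith [sum_integral_diffSum_le hM hNM hc hN hJp, sum_integral_diffSum_le hM hNM hc hN hJm]
  · intro t z hz
    have hp := norm_sq_sum_le_diffSum M hJp t z hz
    have hm := norm_sq_sum_le_diffSum M hJm t z⁻¹ (by rw [norm_inv, hz, inv_one])
    have e : ∑ k ∈ Jm, z⁻¹ ^ k * Complex.exp (-(t * symbol M k) * Complex.I) =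
        ∑ k ∈ J.filter (fun k => ¬ 0 ≤ k), z ^ k * Complex.exp (-(t * symbol M k) * Complex.I) := by
      rw [Finset.sum_image (fun a _ b _ h => neg_injective h)]
      refine Finset.sum_congr rfl fun k _ => ?_
      have : symbol M (-k) = symbol M k := by unfold symbol; push_cast; rw [mul_neg, Real.cos_neg]
      rw [this, inv_zpow', neg_neg]
    rw [e] at hm
    rw [← Finset.sum_filter_add_sum_filter_not J (fun k => 0 ≤ k)]
    set A := ∑ k ∈ J.filter (fun k => 0 ≤ k), z ^ k * Complex.exp (-(t * symbol M k) * Complex.I)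
    set B := ∑ k ∈ J.filter (fun k => ¬ 0 ≤ k), z ^ k * Complex.exp (-(t * symbol M k) * Complex.I)
    have h1 : ‖A + B‖ ^ 2 ≤ (‖A‖ + ‖B‖) ^ 2 := by gcongr; exact norm_add_le _ _
    nlinarith [sq_nonneg (‖A‖ - ‖B‖)]

/-! ### The space-time estimate by duality -/

/-- A measurable extremizer for the duality between the sup norm and the `ℓ¹` norm. -/
lemma exists_measurable_dual {X : Type*} [Fintype X] [Nonempty X] {v : ℝ → X → ℂ}
    (hv : Continuous v) :
    ∃ g : ℝ → X → ℂ, (∀ x, Measurable fun t => g t x) ∧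
      (∀ t, ∑ x, g t x * v t x = ((‖v t‖ ^ 2 : ℝ) : ℂ)) ∧ ∀ t, ∑ x, ‖g t x‖ = ‖v t‖ := by
  let E : X → Set ℝ := fun x => {t | ‖v t‖ ≤ ‖v t x‖}
  have hvx : ∀ x, Continuous fun t => v t x := fun x => (continuous_apply x).comp hv
  have hE : ∀ x, MeasurableSet (E x) := fun x =>
    (isClosed_le hv.norm (hvx x).norm).measurableSet
  let w : X → ℝ → ℝ := fun x => (E x).indicator 1
  have hw : ∀ x, Measurable (w x) := fun x => measurable_one.indicator (hE x)
  have hw0 : ∀ x t, 0 ≤ w x t := fun x t => Set.indicator_nonneg (by simp) t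
  let n : ℝ → ℝ := fun t => ∑ x, w x t
  have hn : Measurable n := Finset.measurable_fun_sum _ fun x _ => hw x
  have hpos : ∀ t, 0 < n t := by
    intro t
    obtain ⟨x, -, hx⟩ := Finset.exists_max_image (Finset.univ : Finset X) (fun x => ‖v t x‖)
      Finset.univ_nonempty
    have hx' : t ∈ E x := (pi_norm_le_iff_of_nonneg (norm_nonneg _)).2 fun y => hx y (by simp)
    have h1 : w x t = 1 := by simp [w, hx']
    have h2 : w x t ≤ n t :=
      Finset.single_le_sum (f := fun x => w x t) (fun y _ => hw0 y t) (Finset.mem_univ x)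
    linarith
  have hwv : ∀ x t, w x t * ‖v t x‖ = w x t * ‖v t‖ := by
    intro x t
    by_cases h : t ∈ E x
    · rw [le_antisymm (norm_le_pi_norm (v t) x) h]
    · simp [w, h]
  have hwv2 : ∀ x t, w x t * ‖v t x‖ ^ 2 = w x t * ‖v t‖ ^ 2 := by
    intro x t
    rw [pow_two, ← mul_assoc, hwv, mul_right_comm, hwv]; ring
  refine ⟨fun t x => ((w x t / n t : ℝ) : ℂ) * conj (v t x), ?_, ?_, ?_⟩
  · intro x
    exact (Complex.measurable_ofReal.comp ((hw x).div hn)).mul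
      (Complex.continuous_conj.comp (hvx x)).measurable
  · intro t
    have : ∀ x, ((w x t / n t : ℝ) : ℂ) * conj (v t x) * v t x =
        ((w x t * ‖v t‖ ^ 2 / n t : ℝ) : ℂ) := by
      intro x
      rw [mul_assoc, mul_comm (conj _), Complex.mul_conj, Complex.normSq_eq_norm_sq,
        ← Complex.ofReal_mul, ← hwv2]
      congr 1; ring
    simp_rw [this]
    rw [← Complex.ofReal_sum, ← Finset.sum_div, ← Finset.sum_mul]
    congr 1
    change n t * _ / n t = _
    field_simp [(hpos t).ne']
  · intro t
    have : ∀ x, ‖((w x t / n t : ℝ) : ℂ) * conj (v t x)‖ = w x t * ‖v t‖ / n t := by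
      intro x
      rw [norm_mul, Complex.norm_real, RCLike.norm_conj, Real.norm_eq_abs,
        abs_of_nonneg (div_nonneg (hw0 x t) (hpos t).le), ← hwv]
      ring
    simp_rw [this]
    rw [← Finset.sum_div, ← Finset.sum_mul]
    change n t * _ / n t = _
    field_simp [(hpos t).ne']

lemma integral_kernel_le {κ : ℝ → ℝ} (hκ : Continuous κ) (h0 : ∀ t, 0 ≤ κ t) {t : ℝ}
    (ht : t ∈ Set.Icc (0 : ℝ) 1) :
    ∫ s in (0 : ℝ)..1, κ (t - s) ≤ ∫ s in (-1 : ℝ)..1, κ s := by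
  rw [intervalIntegral.integral_comp_sub_left]
  exact intervalIntegral.integral_mono_interval (by linarith [ht.1]) (by linarith)
    (by linarith [ht.2]) (Filter.Eventually.of_forall h0) (hκ.intervalIntegrable _ _)

lemma integral_kernel_le' {κ : ℝ → ℝ} (hκ : Continuous κ) (h0 : ∀ t, 0 ≤ κ t) {s : ℝ}
    (hs : s ∈ Set.Icc (0 : ℝ) 1) :
    ∫ t in (0 : ℝ)..1, κ (t - s) ≤ ∫ s in (-1 : ℝ)..1, κ s := by
  rw [intervalIntegral.integral_comp_sub_right]
  exact intervalIntegral.integral_mono_interval (by linarith [hs.2]) (by linarith)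
    (by linarith [hs.1]) (Filter.Eventually.of_forall h0) (hκ.intervalIntegrable _ _)

lemma integral_integral_swap_of_continuous {F : ℝ → ℝ → ℝ} (hF : Continuous F.uncurry) :
    ∫ t in (0 : ℝ)..1, ∫ s in (0 : ℝ)..1, F t s = ∫ s in (0 : ℝ)..1, ∫ t in (0 : ℝ)..1, F t s := by
  refine MeasureTheory.intervalIntegral_intervalIntegral_swap ?_
  refine (hF.continuousOn.integrableOn_compact
    ((isCompact_Icc (a := (0 : ℝ)) (b := 1)).prod (isCompact_Icc (a := (0 : ℝ)) (b := 1)))).mono_set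
    ?_
  rw [Set.uIoc_of_le zero_le_one]
  exact Set.prod_mono Set.Ioc_subset_Icc_self Set.Ioc_subset_Icc_self

/-- Schur's test for a convolution kernel on the unit interval. -/
lemma schur_test {κ a : ℝ → ℝ} (hκ : Continuous κ) (h0 : ∀ t, 0 ≤ κ t) (ha : Continuous a) :
    ∫ t in (0 : ℝ)..1, a t * ∫ s in (0 : ℝ)..1, a s * κ (t - s) ≤
      (∫ s in (-1 : ℝ)..1, κ s) * ∫ t in (0 : ℝ)..1, a t ^ 2 := by
  set K := ∫ s in (-1 : ℝ)..1, κ s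
  have c1 : Continuous fun t => ∫ s in (0 : ℝ)..1, a s * κ (t - s) :=
    intervalIntegral.continuous_parametric_intervalIntegral_of_continuous' (by fun_prop) _ _
  have c2 : Continuous fun t => ∫ s in (0 : ℝ)..1, κ (t - s) :=
    intervalIntegral.continuous_parametric_intervalIntegral_of_continuous' (by fun_prop) _ _
  have c3 : Continuous fun t => ∫ s in (0 : ℝ)..1, a s ^ 2 * κ (t - s) :=
    intervalIntegral.continuous_parametric_intervalIntegral_of_continuous' (by fun_prop) _ _
  have c4 : Continuous fun s => ∫ t in (0 : ℝ)..1, κ (t - s) :=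
    intervalIntegral.continuous_parametric_intervalIntegral_of_continuous' (by fun_prop) _ _
  have step1 : ∫ t in (0 : ℝ)..1, a t * ∫ s in (0 : ℝ)..1, a s * κ (t - s) ≤
      ∫ t in (0 : ℝ)..1, (1 / 2 * (a t ^ 2 * ∫ s in (0 : ℝ)..1, κ (t - s)) +
        1 / 2 * ∫ s in (0 : ℝ)..1, a s ^ 2 * κ (t - s)) := by
    refine intervalIntegral.integral_mono_on zero_le_one
      (Continuous.intervalIntegrable (by fun_prop) _ _)
      (Continuous.intervalIntegrable (by fun_prop) _ _) fun t _ => ?_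
    rw [← intervalIntegral.integral_const_mul, ← intervalIntegral.integral_const_mul,
      ← intervalIntegral.integral_const_mul, ← intervalIntegral.integral_const_mul,
      ← intervalIntegral.integral_add (Continuous.intervalIntegrable (by fun_prop) _ _)
      (Continuous.intervalIntegrable (by fun_prop) _ _)]
    refine intervalIntegral.integral_mono_on zero_le_one
      (Continuous.intervalIntegrable (by fun_prop) _ _)
      (Continuous.intervalIntegrable (by fun_prop) _ _) fun s _ => ?_
    nlinarith [mul_nonneg (sq_nonneg (a t - a s)) (h0 (t - s))]
  have step2 : ∫ t in (0 : ℝ)..1, a t ^ 2 * ∫ s in (0 : ℝ)..1, κ (t - s) ≤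
      K * ∫ t in (0 : ℝ)..1, a t ^ 2 := by
    rw [← intervalIntegral.integral_const_mul]
    refine intervalIntegral.integral_mono_on zero_le_one
      (Continuous.intervalIntegrable (by fun_prop) _ _)
      (Continuous.intervalIntegrable (by fun_prop) _ _) fun t ht => ?_
    rw [mul_comm K]
    exact mul_le_mul_of_nonneg_left (integral_kernel_le hκ h0 ht) (sq_nonneg _)
  have step3 : ∫ t in (0 : ℝ)..1, ∫ s in (0 : ℝ)..1, a s ^ 2 * κ (t - s) ≤
      K * ∫ t in (0 : ℝ)..1, a t ^ 2 := by
    rw [integral_integral_swap_of_continuous (by fun_prop)]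
    rw [← intervalIntegral.integral_const_mul]
    have : ∀ s, ∫ t in (0 : ℝ)..1, a s ^ 2 * κ (t - s) =
        a s ^ 2 * ∫ t in (0 : ℝ)..1, κ (t - s) := fun s => intervalIntegral.integral_const_mul _ _
    simp_rw [this]
    refine intervalIntegral.integral_mono_on zero_le_one
      (Continuous.intervalIntegrable (by fun_prop) _ _)
      (Continuous.intervalIntegrable (by fun_prop) _ _) fun t ht => ?_
    rw [mul_comm K]
    exact mul_le_mul_of_nonneg_left (integral_kernel_le' hκ h0 ht) (sq_nonneg _)
  rw [intervalIntegral.integral_add (Continuous.intervalIntegrable (by fun_prop) _ _)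
      (Continuous.intervalIntegrable (by fun_prop) _ _), intervalIntegral.integral_const_mul,
      intervalIntegral.integral_const_mul] at step1
  linarith

/-- **Space-time estimate.** If the kernels `∑_k e_k(x) conj(e_k(y)) e^{-iω_k t}` are bounded by
`κ t`, the sum `∑_k c_k e_k(x) e^{-iω_k t}` is bounded in `L²([0,1]; ℓ^∞)` by the square root of
`∫ κ` times the `ℓ²` norm of `c`: this is the `T T*` argument. -/
lemma integral_norm_sq_le_of_kernel {ι X : Type*} [Fintype X] [Nonempty X] (S : Finset ι)
    (om : ι → ℝ) (e : ι → X → ℂ) {κ : ℝ → ℝ} (hκ : Continuous κ)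
    (hker : ∀ (t : ℝ) x y, ‖∑ k ∈ S, e k x * conj (e k y) * Complex.exp (-(t * om k) * Complex.I)‖ ≤ κ t)
    (c : ι → ℂ) :
    ∫ t in (0 : ℝ)..1,
      ‖fun x => ∑ k ∈ S, c k * (e k x * Complex.exp (-(t * om k) * Complex.I))‖ ^ 2 ≤
      (∫ t in (-1 : ℝ)..1, κ t) * ∑ k ∈ S, ‖c k‖ ^ 2 := by
  set K := ∫ t in (-1 : ℝ)..1, κ t with hK
  set v : ℝ → X → ℂ := fun t x => ∑ k ∈ S, c k * (e k x * Complex.exp (-(t * om k) * Complex.I))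
    with hv
  have cv : Continuous v := by
    refine continuous_pi fun x => ?_
    simp only [hv]
    fun_prop
  have h0 : ∀ t, 0 ≤ κ t := fun t =>
    (norm_nonneg _).trans (hker t (Classical.arbitrary X) (Classical.arbitrary X))
  have hK0 : 0 ≤ K := intervalIntegral.integral_nonneg (by norm_num) fun t _ => h0 t
  obtain ⟨g, gm, g1, g2⟩ := exists_measurable_dual cv
  have gle : ∀ t x, ‖g t x‖ ≤ ‖v t‖ := fun t x => by
    rw [← g2 t]
    exact Finset.single_le_sum (f := fun x => ‖g t x‖) (fun _ _ => norm_nonneg _)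
      (Finset.mem_univ x)
  -- `g` is bounded by a continuous function, hence integrable against continuous factors
  have gi : ∀ x (φ : ℝ → ℂ), Continuous φ →
      IntervalIntegrable (fun t => g t x * φ t) MeasureTheory.volume 0 1 := by
    intro x φ hφ
    refine IntervalIntegrable.mono_fun ((cv.norm.mul hφ.norm).intervalIntegrable 0 1)
      ((gm x).mul hφ.measurable).aestronglyMeasurable (Filter.Eventually.of_forall fun t => ?_)
    simp only [norm_mul, Pi.mul_apply]
    rw [norm_norm, norm_norm]
    exact mul_le_mul_of_nonneg_right (gle t x) (norm_nonneg _)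
  let E : ι → X → ℝ → ℂ := fun k x t => e k x * Complex.exp (-(t * om k) * Complex.I)
  have cE : ∀ k x, Continuous (E k x) := fun k x => by fun_prop
  let b : ι → ℂ := fun k => ∫ t in (0 : ℝ)..1, ∑ x, g t x * E k x t
  have ib : ∀ k, IntervalIntegrable (fun t => ∑ x, g t x * E k x t) MeasureTheory.volume 0 1 := by
    intro k
    have := IntervalIntegrable.sum Finset.univ (f := fun x t => g t x * E k x t)
      (μ := MeasureTheory.volume) (a := 0) (b := 1) (fun x _ => gi x _ (cE k x))
    simpa only [Finset.sum_fn] using this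
  -- pairing `g` with an arbitrary combination of the modes
  have pairing : ∀ d : ι → ℂ, ∑ k ∈ S, d k * b k =
      ∫ t in (0 : ℝ)..1, ∑ x, g t x * ∑ k ∈ S, d k * E k x t := by
    intro d
    have : ∀ t, ∑ x, g t x * ∑ k ∈ S, d k * E k x t =
        ∑ k ∈ S, d k * ∑ x, g t x * E k x t := by
      intro t
      simp_rw [Finset.mul_sum]
      rw [Finset.sum_comm]
      exact Finset.sum_congr rfl fun k _ => Finset.sum_congr rfl fun x _ => by ring
    simp_rw [this]
    rw [intervalIntegral.integral_finsetSum fun k _ => (ib k).const_mul (d k)]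
    exact Finset.sum_congr rfl fun k _ => (intervalIntegral.integral_const_mul _ _).symm
  set Y := ∫ t in (0 : ℝ)..1, ‖v t‖ ^ 2 with hY
  have hY0 : 0 ≤ Y := intervalIntegral.integral_nonneg zero_le_one fun t _ => sq_nonneg _
  have hYb : (Y : ℂ) = ∑ k ∈ S, c k * b k := by
    rw [pairing, hY, ← intervalIntegral.integral_ofReal]
    exact intervalIntegral.integral_congr fun t _ => (g1 t).symm
  have hb : ∑ k ∈ S, ‖b k‖ ^ 2 ≤ K * Y := by
    have e1 : ((∑ k ∈ S, ‖b k‖ ^ 2 : ℝ) : ℂ) = ∑ k ∈ S, conj (b k) * b k := by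
      push_cast
      refine Finset.sum_congr rfl fun k _ => ?_
      rw [mul_comm, Complex.mul_conj, Complex.normSq_eq_norm_sq]; push_cast; rfl
    have hH : ∀ t x, ‖∑ k ∈ S, conj (b k) * E k x t‖ ≤ ∫ s in (0 : ℝ)..1, ‖v s‖ * κ (t - s) := by
      intro t x
      have e2 : conj (∑ k ∈ S, conj (b k) * E k x t) =
          ∫ s in (0 : ℝ)..1, ∑ y, g s y * ∑ k ∈ S, conj (E k x t) * E k y s := by
        rw [← pairing, map_sum]
        refine Finset.sum_congr rfl fun k _ => ?_
        rw [map_mul, Complex.conj_conj, mul_comm]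
      rw [← RCLike.norm_conj, e2]
      refine intervalIntegral.norm_integral_le_of_norm_le zero_le_one
        (Filter.Eventually.of_forall fun s _ => ?_)
        (Continuous.intervalIntegrable (by fun_prop) _ _)
      refine (norm_sum_le _ _).trans ?_
      rw [← g2 s, Finset.sum_mul]
      refine Finset.sum_le_sum fun y _ => ?_
      rw [norm_mul]
      refine mul_le_mul_of_nonneg_left ?_ (norm_nonneg _)
      rw [← RCLike.norm_conj]
      refine le_trans (le_of_eq ?_) (hker (t - s) x y)
      congr 1
      rw [map_sum]
      refine Finset.sum_congr rfl fun k _ => ?_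
      have e3 : Complex.exp (-(((t - s : ℝ) : ℂ) * om k) * Complex.I) =
          Complex.exp (-(t * om k) * Complex.I) * conj (Complex.exp (-(s * om k) * Complex.I)) := by
        rw [← Complex.exp_conj, ← Complex.exp_add]; congr 1; simp; ring
      rw [e3]
      simp only [E, map_mul, Complex.conj_conj]
      ring
    have e4 : ∑ k ∈ S, ‖b k‖ ^ 2 = ‖((∑ k ∈ S, ‖b k‖ ^ 2 : ℝ) : ℂ)‖ := by
      rw [Complex.norm_real, Real.norm_eq_abs, abs_of_nonneg (by positivity)]
    rw [e4, e1, pairing]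
    refine le_trans ?_ (schur_test hκ h0 cv.norm)
    refine intervalIntegral.norm_integral_le_of_norm_le zero_le_one
        (Filter.Eventually.of_forall fun t _ => ?_) (Continuous.intervalIntegrable ?_ _ _)
    · refine (norm_sum_le _ _).trans ?_
      rw [← g2 t, Finset.sum_mul]
      refine Finset.sum_le_sum fun x _ => ?_
      rw [norm_mul]
      exact mul_le_mul_of_nonneg_left (hH t x) (norm_nonneg _)
    · exact cv.norm.mul (intervalIntegral.continuous_parametric_intervalIntegral_of_continuous'
        (by fun_prop) _ _)
  have hYle : Y ≤ ∑ k ∈ S, ‖c k‖ * ‖b k‖ := by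
    have : Y = ‖(Y : ℂ)‖ := by rw [Complex.norm_real, Real.norm_eq_abs, abs_of_nonneg hY0]
    rw [this, hYb]
    refine (norm_sum_le _ _).trans (Finset.sum_le_sum fun k _ => (norm_mul _ _).le)
  have hCS := Finset.sum_mul_sq_le_sq_mul_sq S (fun k => ‖c k‖) (fun k => ‖b k‖)
  have hfin : Y * Y ≤ (K * ∑ k ∈ S, ‖c k‖ ^ 2) * Y := by
    calc Y * Y ≤ (∑ k ∈ S, ‖c k‖ * ‖b k‖) ^ 2 := by rw [← pow_two]; gcongr
      _ ≤ _ := hCS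
      _ ≤ (∑ k ∈ S, ‖c k‖ ^ 2) * (K * Y) := by gcongr
      _ = _ := by ring
  rcases hY0.eq_or_lt with h | h
  · rw [← h]; positivity
  · exact le_of_mul_le_mul_right hfin h

/-- The `L²([0,1]; ℓ^∞)` norm of a Duhamel formula, by Minkowski and Cauchy-Schwarz. -/
lemma integral_norm_sq_duhamel_le {X : Type*} [Fintype X] {V V0 : ℝ → X → ℂ} {V1 : ℝ → ℝ → X → ℂ}
    (hV : Continuous V) (hV0 : Continuous V0) (hV1 : Continuous V1.uncurry)
    (h : ∀ t x, V t x = V0 t x + ∫ s in (0 : ℝ)..t, V1 s t x) :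
    ∫ t in (0 : ℝ)..1, ‖V t‖ ^ 2 ≤ 2 * (∫ t in (0 : ℝ)..1, ‖V0 t‖ ^ 2) +
      2 * ∫ s in (0 : ℝ)..1, ∫ t in (0 : ℝ)..1, ‖V1 s t‖ ^ 2 := by
  have c2 : Continuous (Function.uncurry fun s t => ‖V1 s t‖ ^ 2) := hV1.norm.pow 2
  have c2' : Continuous (Function.uncurry fun t s => ‖V1 s t‖ ^ 2) := c2.comp continuous_swap
  have c3 : Continuous fun t => ∫ s in (0 : ℝ)..1, ‖V1 s t‖ ^ 2 :=
    intervalIntegral.continuous_parametric_intervalIntegral_of_continuous' c2' _ _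
  have pt : ∀ t ∈ Set.Icc (0 : ℝ) 1, ‖V t‖ ^ 2 ≤
      2 * ‖V0 t‖ ^ 2 + 2 * ∫ s in (0 : ℝ)..1, ‖V1 s t‖ ^ 2 := by
    intro t ht
    have cs : Continuous fun s => ‖V1 s t‖ :=
      (hV1.comp (continuous_id.prodMk continuous_const)).norm
    set m := ∫ s in (0 : ℝ)..1, ‖V1 s t‖ with hm
    have h1 : ‖V t‖ ≤ ‖V0 t‖ + m := by
      have hm0 : 0 ≤ m := intervalIntegral.integral_nonneg zero_le_one fun _ _ => norm_nonneg _
      refine (pi_norm_le_iff_of_nonneg (by positivity)).2 fun x => ?_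
      rw [h]
      refine (norm_add_le _ _).trans (add_le_add (norm_le_pi_norm _ x) ?_)
      refine (intervalIntegral.norm_integral_le_of_norm_le ht.1
        (Filter.Eventually.of_forall fun s _ => norm_le_pi_norm (V1 s t) x)
        (cs.intervalIntegrable _ _)).trans ?_
      exact intervalIntegral.integral_mono_interval le_rfl ht.1 ht.2
        (Filter.Eventually.of_forall fun s => norm_nonneg _) (cs.intervalIntegrable _ _)
    -- Cauchy-Schwarz on the unit interval, as the positivity of a variance
    have h2 : m ^ 2 ≤ ∫ s in (0 : ℝ)..1, ‖V1 s t‖ ^ 2 := by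
      have h3 : 0 ≤ ∫ s in (0 : ℝ)..1, (‖V1 s t‖ - m) ^ 2 :=
        intervalIntegral.integral_nonneg zero_le_one fun _ _ => sq_nonneg _
      have h4 : ∀ s, (‖V1 s t‖ - m) ^ 2 = ‖V1 s t‖ ^ 2 - (2 * m * ‖V1 s t‖ - m ^ 2) :=
        fun s => by ring
      simp_rw [h4] at h3
      rw [intervalIntegral.integral_sub (Continuous.intervalIntegrable (by fun_prop) _ _)
        (Continuous.intervalIntegrable (by fun_prop) _ _),
        intervalIntegral.integral_sub (Continuous.intervalIntegrable (by fun_prop) _ _)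
        (Continuous.intervalIntegrable (by fun_prop) _ _), intervalIntegral.integral_const_mul,
        ← hm] at h3
      simp at h3
      nlinarith
    have h5 : ‖V t‖ ^ 2 ≤ (‖V0 t‖ + m) ^ 2 := by gcongr
    nlinarith [sq_nonneg (‖V0 t‖ - m)]
  have step1 := intervalIntegral.integral_mono_on zero_le_one
    ((hV.norm.pow 2).intervalIntegrable (μ := MeasureTheory.volume) 0 1)
    (Continuous.intervalIntegrable (by fun_prop) _ _) pt
  refine step1.trans (le_of_eq ?_)
  rw [intervalIntegral.integral_add (Continuous.intervalIntegrable (by fun_prop) _ _)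
    (Continuous.intervalIntegrable (by fun_prop) _ _), intervalIntegral.integral_const_mul,
    intervalIntegral.integral_const_mul,
    integral_integral_swap_of_continuous (F := fun t s => ‖V1 s t‖ ^ 2) c2']

/-- The space-time estimate with coefficients depending on time. -/
lemma integral_norm_sq_le_of_kernel_duhamel {ι X : Type*} [Fintype X] [Nonempty X] (S : Finset ι)
    (om : ι → ℝ) (e : ι → X → ℂ) {κ : ℝ → ℝ} (hκ : Continuous κ)
    (hker : ∀ (t : ℝ) x y,
      ‖∑ k ∈ S, e k x * conj (e k y) * Complex.exp (-(t * om k) * Complex.I)‖ ≤ κ t)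
    (c c' : ℝ → ι → ℂ) (hc : ∀ k ∈ S, ∀ t, HasDerivAt (fun t => c t k) (c' t k) t)
    (hc' : ∀ k ∈ S, Continuous fun t => c' t k) :
    ∫ t in (0 : ℝ)..1,
      ‖fun x => ∑ k ∈ S, c t k * (e k x * Complex.exp (-(t * om k) * Complex.I))‖ ^ 2 ≤
      2 * (∫ t in (-1 : ℝ)..1, κ t) *
        (∑ k ∈ S, ‖c 0 k‖ ^ 2 + ∫ s in (0 : ℝ)..1, ∑ k ∈ S, ‖c' s k‖ ^ 2) := by
  have cc : ∀ k ∈ S, Continuous fun t => c t k := fun k hk =>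
    continuous_iff_continuousAt.2 fun t => (hc k hk t).continuousAt
  have cE : ∀ k x, Continuous fun t : ℝ => e k x * Complex.exp (-(t * om k) * Complex.I) :=
    fun k x => by fun_prop
  have c1 : Continuous (Function.uncurry fun s t : ℝ => fun x =>
      ∑ k ∈ S, c' s k * (e k x * Complex.exp (-(t * om k) * Complex.I))) := by
    refine continuous_pi fun x => continuous_finsetSum _ fun k hk =>
      ((hc' k hk).comp continuous_fst).mul ((cE k x).comp continuous_snd)
  have main := integral_norm_sq_duhamel_le
    (V := fun t x => ∑ k ∈ S, c t k * (e k x * Complex.exp (-(t * om k) * Complex.I)))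
    (V0 := fun t x => ∑ k ∈ S, c 0 k * (e k x * Complex.exp (-(t * om k) * Complex.I)))
    (continuous_pi fun x => continuous_finsetSum _ fun k hk => (cc k hk).mul (cE k x))
    (continuous_pi fun x => continuous_finsetSum _ fun k hk => continuous_const.mul (cE k x))
    c1 (by
      intro t x
      have hi : ∀ k ∈ S, IntervalIntegrable
          (fun s => c' s k * (e k x * Complex.exp (-(t * om k) * Complex.I)))
          MeasureTheory.volume 0 t := fun k hk =>
        ((hc' k hk).mul continuous_const).intervalIntegrable _ _
      rw [intervalIntegral.integral_finsetSum hi, ← Finset.sum_add_distrib]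
      refine Finset.sum_congr rfl fun k hk => ?_
      rw [intervalIntegral.integral_mul_const, intervalIntegral.integral_eq_sub_of_hasDerivAt
        (fun s _ => hc k hk s) ((hc' k hk).intervalIntegrable _ _)]
      ring)
  have h1 := integral_norm_sq_le_of_kernel S om e hκ hker (c 0)
  have c3 : Continuous fun s => (∫ t in (-1 : ℝ)..1, κ t) * ∑ k ∈ S, ‖c' s k‖ ^ 2 :=
    continuous_const.mul (continuous_finsetSum _ fun k hk => (hc' k hk).norm.pow 2)
  have h2 := intervalIntegral.integral_mono_on zero_le_one
    ((intervalIntegral.continuous_parametric_intervalIntegral_of_continuous'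
      (c1.norm.pow 2) 0 1).intervalIntegrable (μ := MeasureTheory.volume) 0 1)
    (c3.intervalIntegrable 0 1)
    (fun s _ => integral_norm_sq_le_of_kernel S om e hκ hker (c' s))
  rw [intervalIntegral.integral_const_mul] at h2
  refine main.trans ?_
  rw [mul_add, mul_assoc, mul_assoc]
  exact add_le_add (mul_le_mul_of_nonneg_left h1 zero_le_two)
    (mul_le_mul_of_nonneg_left h2 zero_le_two)

/-! ### Fourier analysis on the periodic lattice -/

lemma meshSize_pos (M : ℕ) [NeZero M] : 0 < meshSize M :=
  div_pos Real.pi_pos (by exact_mod_cast NeZero.pos M)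

lemma meshSize_mul (M : ℕ) [NeZero M] : meshSize M * (2 * M) = 2 * Real.pi := by
  have : (M : ℝ) ≠ 0 := by exact_mod_cast NeZero.ne M
  unfold meshSize; field_simp

/-- The plane wave `e^{ik·x}` on the periodic lattice, as a product of additive characters. -/
noncomputable def wave {d M : ℕ} [NeZero M] (k : Fin d → ℤ) (x : Lattice d M) : ℂ :=
  ∏ j, ZMod.stdAddChar ((k j : ZMod (2 * M)) * x j)

lemma stdAddChar_eq_exp {M : ℕ} [NeZero M] (k : ℤ) :
    ZMod.stdAddChar (k : ZMod (2 * M)) = Complex.exp (((meshSize M * k : ℝ) : ℂ) * Complex.I) := by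
  rw [ZMod.stdAddChar_coe]
  congr 1
  have : (M : ℂ) ≠ 0 := by exact_mod_cast NeZero.ne M
  unfold meshSize
  push_cast
  field_simp

lemma norm_stdAddChar {n : ℕ} [NeZero n] (x : ZMod n) : ‖ZMod.stdAddChar x‖ = 1 := by
  simp

lemma conj_stdAddChar {n : ℕ} [NeZero n] (x : ZMod n) :
    conj (ZMod.stdAddChar x) = ZMod.stdAddChar (-x) := by
  rw [AddChar.map_neg_eq_inv, Complex.inv_def, Complex.normSq_eq_norm_sq, norm_stdAddChar]; simp

lemma norm_wave {d M : ℕ} [NeZero M] (k : Fin d → ℤ) (x : Lattice d M) : ‖wave k x‖ = 1 := by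
  unfold wave; rw [norm_prod]; simp

lemma wave_eq_exp {d M : ℕ} [NeZero M] (k : Fin d → ℤ) (x : Lattice d M) :
    wave k x = Complex.exp (Complex.I * ((∑ j : Fin d, (k j : ℝ) * coord x j : ℝ) : ℂ)) := by
  unfold wave coord
  rw [Complex.ofReal_sum, Finset.mul_sum, Complex.exp_sum]
  refine Finset.prod_congr rfl fun j _ => ?_
  have : (k j : ZMod (2 * M)) * x j = ((k j * ((x j).val : ℤ) : ℤ) : ZMod (2 * M)) := by
    push_cast; rw [ZMod.natCast_zmod_val]
  rw [this, stdAddChar_eq_exp]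
  congr 1
  push_cast; ring

lemma wave_add {d M : ℕ} [NeZero M] (k : Fin d → ℤ) (x y : Lattice d M) :
    wave k (x + y) = wave k x * wave k y := by
  unfold wave
  rw [← Finset.prod_mul_distrib]
  refine Finset.prod_congr rfl fun j _ => ?_
  rw [← AddChar.map_add_eq_mul, Pi.add_apply, mul_add]

lemma conj_wave {d M : ℕ} [NeZero M] (k : Fin d → ℤ) (x : Lattice d M) :
    conj (wave k x) = wave k (-x) := by
  unfold wave
  rw [map_prod]
  refine Finset.prod_congr rfl fun j _ => ?_
  rw [conj_stdAddChar, Pi.neg_apply, mul_neg]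

lemma wave_mul_conj {d M : ℕ} [NeZero M] (k : Fin d → ℤ) (x y : Lattice d M) :
    wave k x * conj (wave k y) = wave k (x - y) := by
  rw [conj_wave, ← wave_add, sub_eq_add_neg]

lemma wave_single {d M : ℕ} [NeZero M] (k : Fin d → ℤ) (j : Fin d) :
    wave k (Pi.single j 1 : Lattice d M) =
      Complex.exp (((meshSize M * k j : ℝ) : ℂ) * Complex.I) := by
  unfold wave
  rw [Finset.prod_eq_single j]
  · simp [stdAddChar_eq_exp]
  · intro i _ hi; simp [Pi.single_eq_of_ne hi]
  · simp

lemma sum_Ico_stdAddChar (M : ℕ) [NeZero M] (x : ZMod (2 * M)) :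
    ∑ k ∈ Finset.Ico (-(M : ℤ)) M, ZMod.stdAddChar ((k : ZMod (2 * M)) * x) =
      if x = 0 then (2 * M : ℂ) else 0 := by
  have hinj : Set.InjOn (fun k : ℤ => (k : ZMod (2 * M))) (Finset.Ico (-(M : ℤ)) M) := by
    intro a ha b hb hab
    rw [Finset.mem_coe, Finset.mem_Ico] at ha hb
    have := (ZMod.intCast_eq_intCast_iff_dvd_sub a b (2 * M)).1 hab
    obtain ⟨q, hq⟩ := this
    push_cast at hq
    have hM : (0 : ℤ) < M := by exact_mod_cast NeZero.pos M
    have : q = 0 := by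
      by_contra hne
      rcases lt_or_gt_of_ne hne with h | h
      · have : q ≤ -1 := by omega
        nlinarith
      · have : 1 ≤ q := by omega
        nlinarith
    rw [this] at hq
    omega
  have himg : (Finset.Ico (-(M : ℤ)) M).image (fun k : ℤ => (k : ZMod (2 * M))) = Finset.univ := by
    apply Finset.eq_univ_of_card
    rw [Finset.card_image_of_injOn hinj, Int.card_Ico, ZMod.card]
    omega
  rw [← Finset.sum_image (f := fun a : ZMod (2 * M) => ZMod.stdAddChar (a * x)) hinj, himg,
    AddChar.sum_mulShift x (ZMod.isPrimitive_stdAddChar (2 * M)), ZMod.card]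
  push_cast
  rfl

lemma sum_frequencies_wave {d M : ℕ} [NeZero M] (x : Lattice d M) :
    ∑ k ∈ frequencies d M, wave k x = if x = 0 then (2 * M : ℂ) ^ d else 0 := by
  unfold frequencies wave
  rw [← Finset.prod_univ_sum (fun _ => Finset.Ico (-(M : ℤ)) M)
    (fun j k => ZMod.stdAddChar ((k : ZMod (2 * M)) * x j))]
  simp_rw [sum_Ico_stdAddChar]
  split_ifs with h
  · subst h; simp
  · obtain ⟨j, hj⟩ := Function.ne_iff.1 h
    exact Finset.prod_eq_zero (Finset.mem_univ j) (if_neg hj)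

lemma sum_wave {d M : ℕ} [NeZero M] {k l : Fin d → ℤ} (hk : k ∈ frequencies d M)
    (hl : l ∈ frequencies d M) :
    ∑ x : Lattice d M, wave k x * conj (wave l x) = if k = l then (2 * M : ℂ) ^ d else 0 := by
  have e : ∀ x : Lattice d M, wave k x * conj (wave l x) =
      ∏ j, ZMod.stdAddChar (x j * ((k j - l j : ℤ) : ZMod (2 * M))) := by
    intro x
    unfold wave
    rw [map_prod, ← Finset.prod_mul_distrib]
    refine Finset.prod_congr rfl fun j _ => ?_
    rw [conj_stdAddChar, ← AddChar.map_add_eq_mul]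
    congr 1; push_cast; ring
  simp_rw [e]
  rw [← Fintype.piFinset_univ, ← Finset.prod_univ_sum (fun _ => Finset.univ)
    (fun j (a : ZMod (2 * M)) => ZMod.stdAddChar (a * ((k j - l j : ℤ) : ZMod (2 * M))))]
  simp_rw [AddChar.sum_mulShift _ (ZMod.isPrimitive_stdAddChar (2 * M)), ZMod.card]
  split_ifs with h
  · subst h; simp
  · obtain ⟨j, hj⟩ := Function.ne_iff.1 h
    refine Finset.prod_eq_zero (Finset.mem_univ j) ?_
    rw [if_neg]
    · simp
    · intro h0
      have h1 := (ZMod.intCast_zmod_eq_zero_iff_dvd (k j - l j) (2 * M)).1 h0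
      have hk' := Finset.mem_Ico.1 (Fintype.mem_piFinset.1 hk j)
      have hl' := Finset.mem_Ico.1 (Fintype.mem_piFinset.1 hl j)
      have : k j - l j = 0 := Int.eq_zero_of_abs_lt_dvd h1 (by
        rw [abs_lt]; push_cast; constructor <;> omega)
      exact hj (by omega)

lemma fourier_eq {d M : ℕ} [NeZero M] (f : Lattice d M → ℂ) (k : Fin d → ℤ) :
    fourier f k = ((meshSize M : ℝ) : ℂ) ^ d * ∑ x : Lattice d M, f x * conj (wave k x) := by
  unfold fourier
  congr 1
  refine Finset.sum_congr rfl fun x _ => ?_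
  rw [wave_eq_exp, ← Complex.exp_conj]
  congr 2
  simp

lemma meshSize_pow_mul (d M : ℕ) [NeZero M] :
    ((meshSize M : ℝ) : ℂ) ^ d * (2 * M) ^ d = ((2 * Real.pi : ℝ) : ℂ) ^ d := by
  rw [← mul_pow, ← meshSize_mul M]; push_cast; rfl

/-- Fourier inversion. -/
lemma sum_fourier_mul_wave {d M : ℕ} [NeZero M] (f : Lattice d M → ℂ) (x : Lattice d M) :
    ∑ k ∈ frequencies d M, fourier f k * wave k x = ((2 * Real.pi : ℝ) : ℂ) ^ d * f x := by
  simp_rw [fourier_eq, mul_assoc, Finset.sum_mul]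
  rw [← Finset.mul_sum, Finset.sum_comm]
  have : ∀ y, ∑ k ∈ frequencies d M, f y * conj (wave k y) * wave k x =
      f y * if x - y = 0 then (2 * M : ℂ) ^ d else 0 := by
    intro y
    rw [← sum_frequencies_wave, Finset.mul_sum]
    refine Finset.sum_congr rfl fun k _ => ?_
    rw [mul_assoc, mul_comm (conj _), wave_mul_conj]
  simp_rw [this, sub_eq_zero]
  rw [Finset.sum_eq_single x]
  · rw [if_pos rfl, mul_left_comm, meshSize_pow_mul, mul_comm]
  · intro y _ hy; rw [if_neg (Ne.symm hy), mul_zero]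
  · simp

/-- The mass `‖f‖²_{L²_h} = h^d ∑_x |f(x)|²`. -/
noncomputable def mass {d M : ℕ} [NeZero M] (f : Lattice d M → ℂ) : ℝ :=
  meshSize M ^ d * ∑ x, ‖f x‖ ^ 2

lemma mass_nonneg {d M : ℕ} [NeZero M] (f : Lattice d M → ℂ) : 0 ≤ mass f := by
  have := meshSize_pos M
  unfold mass; positivity

/-- The mass of a trigonometric polynomial. -/
lemma mass_sum_wave {d M : ℕ} [NeZero M] {S : Finset (Fin d → ℤ)} (hS : S ⊆ frequencies d M)
    (c : (Fin d → ℤ) → ℂ) :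
    mass (fun x : Lattice d M => ∑ k ∈ S, c k * wave k x) =
      (2 * Real.pi) ^ d * ∑ k ∈ S, ‖c k‖ ^ 2 := by
  have key : ((mass (fun x : Lattice d M => ∑ k ∈ S, c k * wave k x) : ℝ) : ℂ) =
      (((2 * Real.pi) ^ d * ∑ k ∈ S, ‖c k‖ ^ 2 : ℝ) : ℂ) := by
    unfold mass
    have e : ∀ x : Lattice d M, ((‖∑ k ∈ S, c k * wave k x‖ ^ 2 : ℝ) : ℂ) =
        ∑ k ∈ S, ∑ l ∈ S, c k * conj (c l) * (wave k x * conj (wave l x)) := by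
      intro x
      rw [← Complex.normSq_eq_norm_sq, ← Complex.mul_conj, map_sum, Finset.sum_mul_sum]
      refine Finset.sum_congr rfl fun k _ => Finset.sum_congr rfl fun l _ => ?_
      rw [map_mul]; ring
    rw [Complex.ofReal_mul, Complex.ofReal_sum]
    simp_rw [e]
    rw [Finset.sum_comm]
    have e2 : ∀ k ∈ S, ∑ x : Lattice d M, ∑ l ∈ S, c k * conj (c l) *
        (wave k x * conj (wave l x)) = ((‖c k‖ ^ 2 : ℝ) : ℂ) * (2 * M) ^ d := by
      intro k hk
      rw [Finset.sum_comm]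
      have e3 : ∀ l ∈ S, ∑ x : Lattice d M, c k * conj (c l) * (wave k x * conj (wave l x)) =
          c k * conj (c l) * if k = l then (2 * M : ℂ) ^ d else 0 := by
        intro l hl
        rw [← Finset.mul_sum, sum_wave (hS hk) (hS hl)]
      rw [Finset.sum_congr rfl e3, Finset.sum_eq_single k]
      · rw [if_pos rfl, Complex.mul_conj, Complex.normSq_eq_norm_sq]
      · intro l _ hl; rw [if_neg (Ne.symm hl), mul_zero]
      · intro h; exact absurd hk h
    rw [Finset.sum_congr rfl e2, ← Finset.sum_mul, mul_comm (∑ k ∈ S, _), ← mul_assoc,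
      Complex.ofReal_pow, meshSize_pow_mul]
    push_cast; rfl
  exact_mod_cast key

/-- Plancherel's identity. -/
lemma sum_norm_fourier_sq {d M : ℕ} [NeZero M] (f : Lattice d M → ℂ) :
    ∑ k ∈ frequencies d M, ‖fourier f k‖ ^ 2 = (2 * Real.pi) ^ d * mass f := by
  have h := mass_sum_wave (M := M) (subset_refl (frequencies d M)) (fourier f)
  simp_rw [sum_fourier_mul_wave] at h
  have h2 : mass (fun x => ((2 * Real.pi : ℝ) : ℂ) ^ d * f x) = ((2 * Real.pi) ^ d) ^ 2 * mass f := by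
    unfold mass
    simp_rw [norm_mul, mul_pow, norm_pow, Complex.norm_real, Real.norm_eq_abs]
    rw [← Finset.mul_sum, abs_of_pos (by positivity)]
    ring
  rw [h2] at h
  have hpi : (2 * Real.pi) ^ d ≠ 0 := by positivity
  exact (mul_left_cancel₀ hpi (by rw [← h]; ring)).symm

lemma fourier_comp_add {d M : ℕ} [NeZero M] (f : Lattice d M → ℂ) (y : Lattice d M)
    (k : Fin d → ℤ) : fourier (fun x => f (x + y)) k = wave k y * fourier f k := by
  rw [fourier_eq, fourier_eq, mul_left_comm]
  congr 1
  rw [Finset.mul_sum, ← Equiv.sum_comp (Equiv.addRight y)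
    (fun x => wave k y * (f x * conj (wave k x)))]
  refine Finset.sum_congr rfl fun x _ => ?_
  simp only [Equiv.coe_addRight]
  have h1 : wave k y * conj (wave k y) = 1 := by
    rw [Complex.mul_conj, Complex.normSq_eq_norm_sq, norm_wave]; simp
  rw [wave_add, map_mul]
  linear_combination (-(f (x + y) * conj (wave k x))) * h1

lemma fourier_add {d M : ℕ} [NeZero M] (f g : Lattice d M → ℂ) (k : Fin d → ℤ) :
    fourier (fun x => f x + g x) k = fourier f k + fourier g k := by
  simp_rw [fourier_eq, add_mul, Finset.sum_add_distrib, mul_add]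

lemma fourier_const_mul {d M : ℕ} [NeZero M] (a : ℂ) (f : Lattice d M → ℂ) (k : Fin d → ℤ) :
    fourier (fun x => a * f x) k = a * fourier f k := by
  simp_rw [fourier_eq, mul_assoc, ← Finset.mul_sum, mul_left_comm]

lemma fourier_sum {ι : Type*} (s : Finset ι) {d M : ℕ} [NeZero M] (f : ι → Lattice d M → ℂ)
    (k : Fin d → ℤ) : fourier (fun x => ∑ i ∈ s, f i x) k = ∑ i ∈ s, fourier (f i) k := by
  simp_rw [fourier_eq, Finset.sum_mul]
  rw [Finset.sum_comm, Finset.mul_sum]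

/-- The symbol `∑_j (2 / h²) (1 - cos (h k_j))` of `-Δ_h`. -/
noncomputable def laplaceSymbol {d : ℕ} (M : ℕ) (k : Fin d → ℤ) : ℝ := ∑ j, symbol M (k j)

lemma fourier_discreteLaplacian {d M : ℕ} [NeZero M] (f : Lattice d M → ℂ) (k : Fin d → ℤ) :
    fourier (discreteLaplacian f) k = -(laplaceSymbol M k : ℂ) * fourier f k := by
  have hh : ((meshSize M : ℝ) : ℂ) ≠ 0 := by exact_mod_cast (meshSize_pos M).ne'
  have e : discreteLaplacian f = fun x => ∑ j : Fin d, (((meshSize M : ℝ) : ℂ) ^ 2)⁻¹ *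
      ((f (x + Pi.single j 1) + f (x + -Pi.single j 1)) + (-2) * f x) := by
    funext x
    unfold discreteLaplacian
    refine Finset.sum_congr rfl fun j _ => ?_
    rw [← sub_eq_add_neg]; ring
  rw [e, fourier_sum]
  unfold laplaceSymbol
  rw [Complex.ofReal_sum, ← Finset.sum_neg_distrib, Finset.sum_mul]
  refine Finset.sum_congr rfl fun j _ => ?_
  rw [fourier_const_mul, fourier_add, fourier_add, fourier_const_mul, fourier_comp_add,
    fourier_comp_add, ← conj_wave, wave_single, ← Complex.exp_conj]
  have h2 : (2 * (Real.cos (meshSize M * k j) : ℝ) : ℂ) =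
      Complex.exp (((meshSize M * k j : ℝ) : ℂ) * Complex.I) +
      Complex.exp (conj (((meshSize M * k j : ℝ) : ℂ) * Complex.I)) := by
    rw [Complex.ofReal_cos, Complex.two_cos]
    congr 2
    simp
  unfold symbol
  rw [← add_mul, ← h2]
  push_cast
  field_simp
  ring

/-- The kinetic energy `‖∇_h f‖²_{L²_h}`, with forward difference quotients. -/
noncomputable def kinetic {d M : ℕ} [NeZero M] (f : Lattice d M → ℂ) : ℝ :=
  meshSize M ^ d * ∑ x, ∑ j : Fin d, ‖f (x + Pi.single j 1) - f x‖ ^ 2 / meshSize M ^ 2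

lemma kinetic_nonneg {d M : ℕ} [NeZero M] (f : Lattice d M → ℂ) : 0 ≤ kinetic f := by
  have := meshSize_pos M
  unfold kinetic; positivity

lemma sum_laplaceSymbol_mul_norm_fourier_sq {d M : ℕ} [NeZero M] (f : Lattice d M → ℂ) :
    ∑ k ∈ frequencies d M, laplaceSymbol M k * ‖fourier f k‖ ^ 2 =
      (2 * Real.pi) ^ d * kinetic f := by
  have hh := meshSize_pos M
  have h1 : ∀ j : Fin d, ∑ k ∈ frequencies d M, symbol M (k j) * ‖fourier f k‖ ^ 2 =
      (2 * Real.pi) ^ d *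
        mass (fun x => f (x + Pi.single j 1) - f x) / meshSize M ^ 2 := by
    intro j
    rw [← sum_norm_fourier_sq, Finset.sum_div]
    refine Finset.sum_congr rfl fun k _ => ?_
    have e : (fun x => f (x + Pi.single j 1) - f x) =
        fun x => f (x + Pi.single j 1) + (-1) * f x := by funext x; ring
    rw [e, fourier_add, fourier_const_mul, fourier_comp_add, wave_single]
    have e2 : Complex.exp (((meshSize M * k j : ℝ) : ℂ) * Complex.I) * fourier f k +
        -1 * fourier f k =
        (Complex.exp (((meshSize M * k j : ℝ) : ℂ) * Complex.I) - 1) * fourier f k := by ring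
    rw [e2, norm_mul, mul_pow, ← Complex.normSq_eq_norm_sq (_ - 1)]
    have e3 : Complex.normSq (Complex.exp (((meshSize M * k j : ℝ) : ℂ) * Complex.I) - 1) =
        2 * (1 - Real.cos (meshSize M * k j)) := by
      rw [Complex.normSq_apply, Complex.sub_re, Complex.sub_im, Complex.exp_ofReal_mul_I_re,
        Complex.exp_ofReal_mul_I_im, Complex.one_re, Complex.one_im]
      nlinarith [Real.sin_sq_add_cos_sq (meshSize M * k j)]
    rw [e3]
    unfold symbol
    field_simp
  unfold laplaceSymbol
  simp_rw [Finset.sum_mul]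
  rw [Finset.sum_comm]
  simp_rw [h1]
  unfold kinetic mass
  rw [Finset.sum_comm, Finset.mul_sum, Finset.mul_sum]
  refine Finset.sum_congr rfl fun j _ => ?_
  rw [← Finset.sum_div]; ring

lemma symbol_le_sq (M : ℕ) [NeZero M] (k : ℤ) : symbol M k ≤ (k : ℝ) ^ 2 := by
  have hh := meshSize_pos M
  have := Real.one_sub_sq_div_two_le_cos (x := meshSize M * k)
  calc symbol M k ≤ 2 / meshSize M ^ 2 * ((meshSize M * k) ^ 2 / 2) := by
        unfold symbol; gcongr; linarith
    _ = _ := by field_simp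

lemma sq_le_symbol {M : ℕ} [NeZero M] {k : ℤ} (hk : |k| ≤ M) : (k : ℝ) ^ 2 ≤ 3 * symbol M k := by
  have hh := meshSize_pos M
  have hm := meshSize_mul M
  have hk' : |(k : ℝ)| ≤ M := by exact_mod_cast hk
  have h1 : |meshSize M * k / 2| = meshSize M * |(k : ℝ)| / 2 := by
    rw [abs_div, abs_mul, abs_of_pos hh, abs_of_pos (two_pos : (0 : ℝ) < 2)]
  have h2 := Real.mul_abs_le_abs_sin (x := meshSize M * k / 2) (by rw [h1]; nlinarith)
  have h3 : (2 / Real.pi * |meshSize M * k / 2|) ^ 2 ≤ Real.sin (meshSize M * k / 2) ^ 2 := by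
    rw [← sq_abs (Real.sin _)]; gcongr
  rw [mul_pow, sq_abs] at h3
  have h4 : 1 - Real.cos (meshSize M * k) = 2 * Real.sin (meshSize M * k / 2) ^ 2 := by
    have := Real.cos_two_mul (meshSize M * k / 2)
    rw [Real.cos_sq', show 2 * (meshSize M * (k : ℝ) / 2) = meshSize M * k by ring] at this
    linarith
  have h5 : 2 / meshSize M ^ 2 * (2 * ((2 / Real.pi) ^ 2 * (meshSize M * k / 2) ^ 2)) ≤
      symbol M k := by
    unfold symbol; rw [h4]; gcongr
  have h6 : 2 / meshSize M ^ 2 * (2 * ((2 / Real.pi) ^ 2 * (meshSize M * k / 2) ^ 2)) =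
      4 / Real.pi ^ 2 * (k : ℝ) ^ 2 := by field_simp; ring
  have hpi : Real.pi ^ 2 ≤ 12 := by nlinarith [Real.pi_lt_d2, Real.pi_pos]
  have h7 : 1 / 3 ≤ 4 / Real.pi ^ 2 := by
    rw [div_le_div_iff₀ (by norm_num) (by positivity)]; linarith
  nlinarith [sq_nonneg (k : ℝ)]

lemma abs_le_of_mem_frequencies {d M : ℕ} {k : Fin d → ℤ} (hk : k ∈ frequencies d M) (j : Fin d) :
    |k j| ≤ M := by
  have := Finset.mem_Ico.1 (Fintype.mem_piFinset.1 hk j)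
  rw [abs_le]; constructor <;> omega

lemma sobolevNorm_nonneg {d M : ℕ} [NeZero M] (s : ℝ) (f : Lattice d M → ℂ) :
    0 ≤ sobolevNorm s f := Real.sqrt_nonneg _

lemma sobolevNorm_one_sq {d M : ℕ} [NeZero M] (f : Lattice d M → ℂ) :
    (2 * Real.pi) ^ d * sobolevNorm 1 f ^ 2 =
      ∑ k ∈ frequencies d M, (1 + ∑ j, (k j : ℝ) ^ 2) * ‖fourier f k‖ ^ 2 := by
  unfold sobolevNorm
  simp_rw [Real.rpow_one]
  rw [Real.sq_sqrt (by positivity), ← mul_assoc, mul_inv_cancel₀ (by positivity), one_mul]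

lemma mass_add_kinetic_le {d M : ℕ} [NeZero M] (f : Lattice d M → ℂ) :
    mass f + kinetic f ≤ sobolevNorm 1 f ^ 2 := by
  have hpi : 0 < (2 * Real.pi) ^ d := by positivity
  refine le_of_mul_le_mul_left ?_ hpi
  rw [mul_add, ← sum_norm_fourier_sq, ← sum_laplaceSymbol_mul_norm_fourier_sq,
    sobolevNorm_one_sq, ← Finset.sum_add_distrib]
  refine Finset.sum_le_sum fun k _ => ?_
  rw [add_mul, one_mul]
  gcongr
  exact Finset.sum_le_sum fun j _ => symbol_le_sq M (k j)

lemma sobolevNorm_sq_le {d M : ℕ} [NeZero M] (f : Lattice d M → ℂ) :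
    sobolevNorm 1 f ^ 2 ≤ 3 * (mass f + kinetic f) := by
  have hpi : 0 < (2 * Real.pi) ^ d := by positivity
  refine le_of_mul_le_mul_left ?_ hpi
  rw [mul_left_comm, mul_add, ← sum_norm_fourier_sq, ← sum_laplaceSymbol_mul_norm_fourier_sq,
    sobolevNorm_one_sq, ← Finset.sum_add_distrib, Finset.mul_sum]
  refine Finset.sum_le_sum fun k hk => ?_
  have h1 : ∑ j, (k j : ℝ) ^ 2 ≤ 3 * laplaceSymbol M k := by
    unfold laplaceSymbol
    rw [Finset.mul_sum]
    exact Finset.sum_le_sum fun j _ => sq_le_symbol (abs_le_of_mem_frequencies hk j)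
  nlinarith [sq_nonneg ‖fourier f k‖]

/-! ### Dyadic shells of frequencies and Sobolev inequalities -/

/-- The dyadic level of a frequency: `j` with `2^j ≤ |k|_∞ < 2^(j+1)`, and `0` for `k = 0`. -/
def level (k : Fin 2 → ℤ) : ℕ := Nat.log 2 (max (k 0).natAbs (k 1).natAbs)

/-- The frequencies of dyadic level `j`. -/
noncomputable def shell (M j : ℕ) : Finset (Fin 2 → ℤ) := (frequencies 2 M).filter fun k => level k = j

lemma shell_subset (M j : ℕ) : shell M j ⊆ frequencies 2 M := Finset.filter_subset _ _

lemma four_pow_le_of_mem_shell {M j : ℕ} {k : Fin 2 → ℤ} (hk : k ∈ shell M j) :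
    (4 : ℝ) ^ j ≤ 1 + ∑ i, (k i : ℝ) ^ 2 := by
  have hj : level k = j := (Finset.mem_filter.1 hk).2
  rw [Fin.sum_univ_two]
  rcases eq_or_ne (max (k 0).natAbs (k 1).natAbs) 0 with h0 | h0
  · have : j = 0 := by rw [← hj, level, h0]; simp
    rw [this, pow_zero]
    nlinarith [sq_nonneg (k 0 : ℝ), sq_nonneg (k 1 : ℝ)]
  · have h1 : 2 ^ j ≤ max (k 0).natAbs (k 1).natAbs := by
      rw [← hj]; exact Nat.pow_log_le_self 2 h0
    have h4 : (4 : ℝ) ^ j = ((2 : ℝ) ^ j) ^ 2 := by rw [← pow_mul, mul_comm, pow_mul]; norm_num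
    rw [h4]
    rcases le_max_iff.1 h1 with h | h
    · have h2 : (2 : ℝ) ^ j ≤ |(k 0 : ℝ)| := by
        rw [← Int.cast_abs, Int.abs_eq_natAbs]; exact_mod_cast h
      have h3 : ((2 : ℝ) ^ j) ^ 2 ≤ |(k 0 : ℝ)| ^ 2 := by gcongr
      rw [sq_abs] at h3
      nlinarith [sq_nonneg (k 1 : ℝ)]
    · have h2 : (2 : ℝ) ^ j ≤ |(k 1 : ℝ)| := by
        rw [← Int.cast_abs, Int.abs_eq_natAbs]; exact_mod_cast h
      have h3 : ((2 : ℝ) ^ j) ^ 2 ≤ |(k 1 : ℝ)| ^ 2 := by gcongr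
      rw [sq_abs] at h3
      nlinarith [sq_nonneg (k 0 : ℝ)]

lemma natAbs_le_of_mem_shell {M j : ℕ} {k : Fin 2 → ℤ} (hk : k ∈ shell M j) (i : Fin 2) :
    (k i).natAbs ≤ 2 ^ (j + 1) := by
  have hj : level k = j := (Finset.mem_filter.1 hk).2
  have h1 : max (k 0).natAbs (k 1).natAbs < 2 ^ (j + 1) := by
    rw [← hj]; exact Nat.lt_pow_succ_log_self (by norm_num) _
  fin_cases i
  · exact (le_max_left _ _).trans h1.le
  · exact (le_max_right _ _).trans h1.le

/-- The one-dimensional frequencies of size at most `2^(j+1)`. -/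
noncomputable def dyadicInterval (M j : ℕ) : Finset ℤ :=
  (Finset.Ico (-(M : ℤ)) M).filter fun k => k.natAbs ≤ 2 ^ (j + 1)

lemma shell_subset_box (M j : ℕ) :
    shell M j ⊆ Fintype.piFinset fun _ => dyadicInterval M j := by
  intro k hk
  refine Fintype.mem_piFinset.2 fun i => Finset.mem_filter.2 ⟨?_, natAbs_le_of_mem_shell hk i⟩
  exact Fintype.mem_piFinset.1 (shell_subset M j hk) i

lemma card_shell_le (M j : ℕ) : ((shell M j).card : ℝ) ≤ 25 * 4 ^ j := by
  have h1 := Finset.card_le_card (shell_subset_box M j)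
  rw [Fintype.card_piFinset_const] at h1
  have h2 : (dyadicInterval M j).card ≤ 5 * 2 ^ j := by
    have hsub : dyadicInterval M j ⊆ Finset.Icc (-(2 ^ (j + 1) : ℤ)) (2 ^ (j + 1)) := by
      intro k hk
      have := (Finset.mem_filter.1 hk).2
      have h3 : |k| ≤ 2 ^ (j + 1) := by rw [Int.abs_eq_natAbs]; exact_mod_cast this
      exact Finset.mem_Icc.2 (abs_le.1 h3)
    refine (Finset.card_le_card hsub).trans ?_
    rw [Int.card_Icc]
    have e : (2 : ℤ) ^ (j + 1) = 2 * ((2 ^ j : ℕ) : ℤ) := by push_cast; ring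
    rw [e]
    have : 1 ≤ 2 ^ j := Nat.one_le_two_pow
    omega
  have h3 : ((shell M j).card : ℝ) ≤ (dyadicInterval M j).card ^ 2 := by exact_mod_cast h1
  have h4 : ((dyadicInterval M j).card : ℝ) ≤ 5 * 2 ^ j := by exact_mod_cast h2
  calc _ ≤ _ := h3
    _ ≤ (5 * 2 ^ j : ℝ) ^ 2 := by gcongr
    _ = 25 * (2 ^ 2) ^ j := by rw [mul_pow, ← pow_mul, ← pow_mul, mul_comm j 2]; norm_num
    _ = _ := by norm_num

lemma sum_shell {E : Type*} [AddCommMonoid E] (M : ℕ) (F : (Fin 2 → ℤ) → E) :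
    ∑ j ∈ Finset.range (M + 1), ∑ k ∈ shell M j, F k = ∑ k ∈ frequencies 2 M, F k := by
  refine Finset.sum_fiberwise_of_maps_to (fun k hk => ?_) F
  rw [Finset.mem_range, Nat.lt_succ_iff]
  refine (Nat.log_le_self 2 _).trans (max_le ?_ ?_)
  · have := abs_le.1 (abs_le_of_mem_frequencies hk 0); omega
  · have := abs_le.1 (abs_le_of_mem_frequencies hk 1); omega

/-- The Littlewood-Paley piece of `f` with frequencies in the shell of level `j`. -/
noncomputable def piece {M : ℕ} [NeZero M] (f : Lattice 2 M → ℂ) (j : ℕ) (x : Lattice 2 M) : ℂ :=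
  (((2 * Real.pi : ℝ) : ℂ) ^ 2)⁻¹ * ∑ k ∈ shell M j, fourier f k * wave k x

lemma sum_piece {M : ℕ} [NeZero M] (f : Lattice 2 M → ℂ) (x : Lattice 2 M) :
    f x = ∑ j ∈ Finset.range (M + 1), piece f j x := by
  unfold piece
  have : ((2 * Real.pi : ℝ) : ℂ) ^ 2 ≠ 0 := pow_ne_zero _ (by exact_mod_cast Real.two_pi_pos.ne')
  rw [← Finset.mul_sum, sum_shell, sum_fourier_mul_wave, inv_mul_cancel_left₀ this]

lemma sum_shell_norm_fourier_sq_le {M : ℕ} [NeZero M] (f : Lattice 2 M → ℂ) (j : ℕ) :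
    4 ^ j * ∑ k ∈ shell M j, ‖fourier f k‖ ^ 2 ≤ (2 * Real.pi) ^ 2 * sobolevNorm 1 f ^ 2 := by
  rw [sobolevNorm_one_sq, Finset.mul_sum]
  refine (Finset.sum_le_sum fun k hk => mul_le_mul_of_nonneg_right (four_pow_le_of_mem_shell hk)
    (sq_nonneg _)).trans (Finset.sum_le_sum_of_subset_of_nonneg (shell_subset M j)
    fun k _ _ => by positivity)

/-- Bernstein's inequality for one shell. -/
lemma norm_piece_le {M : ℕ} [NeZero M] (f : Lattice 2 M → ℂ) (j : ℕ) (x : Lattice 2 M) :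
    ‖piece f j x‖ ≤ 5 * sobolevNorm 1 f := by
  have hA := sobolevNorm_nonneg 1 f
  have h1 : ‖∑ k ∈ shell M j, fourier f k * wave k x‖ ≤ ∑ k ∈ shell M j, ‖fourier f k‖ * 1 := by
    refine (norm_sum_le _ _).trans (Finset.sum_le_sum fun k _ => ?_)
    rw [norm_mul, norm_wave]
  have h2 := Finset.sum_mul_sq_le_sq_mul_sq (shell M j) (fun k => ‖fourier f k‖) (fun _ => (1 : ℝ))
  have h3 := sum_shell_norm_fourier_sq_le f j
  have h4 := card_shell_le M j
  simp only [one_pow, Finset.sum_const, nsmul_eq_mul, mul_one] at h1 h2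
  have hS : 0 ≤ ∑ k ∈ shell M j, ‖fourier f k‖ ^ 2 := by positivity
  have h5 : (∑ k ∈ shell M j, ‖fourier f k‖) ^ 2 ≤ 25 * ((2 * Real.pi) ^ 2 * sobolevNorm 1 f ^ 2) := by
    calc _ ≤ _ := h2
      _ ≤ (∑ k ∈ shell M j, ‖fourier f k‖ ^ 2) * (25 * 4 ^ j) := by gcongr
      _ = 25 * (4 ^ j * ∑ k ∈ shell M j, ‖fourier f k‖ ^ 2) := by ring
      _ ≤ _ := by gcongr
  have h6 : ∑ k ∈ shell M j, ‖fourier f k‖ ≤ 5 * (2 * Real.pi * sobolevNorm 1 f) := by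
    refine abs_le_of_sq_le_sq' ?_ (by positivity) |>.2
    calc _ ≤ _ := h5
      _ = _ := by ring
  unfold piece
  rw [norm_mul, norm_inv, norm_pow, Complex.norm_real, Real.norm_eq_abs,
    abs_of_pos Real.two_pi_pos, inv_mul_le_iff₀ (by positivity)]
  have hpi : 1 ≤ 2 * Real.pi := by linarith [Real.pi_gt_three]
  calc _ ≤ 5 * (2 * Real.pi * sobolevNorm 1 f) := h1.trans h6
    _ ≤ 5 * ((2 * Real.pi) ^ 2 * sobolevNorm 1 f) := by gcongr; nlinarith
    _ = _ := by ring

lemma mass_piece {M : ℕ} [NeZero M] (f : Lattice 2 M → ℂ) (j : ℕ) :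
    (2 * Real.pi) ^ 2 * mass (piece f j) = ∑ k ∈ shell M j, ‖fourier f k‖ ^ 2 := by
  have h := mass_sum_wave (M := M) (shell_subset M j)
    (fun k => (((2 * Real.pi : ℝ) : ℂ) ^ 2)⁻¹ * fourier f k)
  have e : (fun x : Lattice 2 M => ∑ k ∈ shell M j,
      (((2 * Real.pi : ℝ) : ℂ) ^ 2)⁻¹ * fourier f k * wave k x) = piece f j := by
    funext x; unfold piece; rw [Finset.mul_sum]
    exact Finset.sum_congr rfl fun k _ => by ring
  rw [e] at h
  rw [h]
  simp_rw [norm_mul, norm_inv, norm_pow, Complex.norm_real, Real.norm_eq_abs,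
    abs_of_pos Real.two_pi_pos, mul_pow]
  rw [← Finset.mul_sum]
  have : (2 * Real.pi) ≠ 0 := Real.two_pi_pos.ne'
  field_simp

lemma mass_piece_le {M : ℕ} [NeZero M] (f : Lattice 2 M → ℂ) (j : ℕ) :
    mass (piece f j) ≤ mass f := by
  have hpi : 0 < (2 * Real.pi) ^ 2 := by positivity
  refine le_of_mul_le_mul_left ?_ hpi
  rw [mass_piece, ← sum_norm_fourier_sq]
  exact Finset.sum_le_sum_of_subset_of_nonneg (shell_subset M j) fun _ _ _ => by positivity

lemma mass_piece_le_sobolev {M : ℕ} [NeZero M] (f : Lattice 2 M → ℂ) (j : ℕ) :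
    mass (piece f j) ≤ (4 ^ j)⁻¹ * sobolevNorm 1 f ^ 2 := by
  have hpi : 0 < (2 * Real.pi) ^ 2 := by positivity
  refine le_of_mul_le_mul_left ?_ hpi
  rw [mass_piece, mul_left_comm, inv_mul_eq_div, le_div_iff₀ (by positivity), mul_comm]
  exact sum_shell_norm_fourier_sq_le f j

/-- Jensen's inequality with geometric weights. -/
lemma exists_rpow_sum_le {r q : ℝ} (hr0 : 0 < r) (hr1 : r < 1) (hq : 1 ≤ q) :
    ∃ C : ℝ, 0 < C ∧ ∀ (n : ℕ) (a : ℕ → ℝ), (∀ j, 0 ≤ a j) →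
      (∑ j ∈ Finset.range n, a j) ^ q ≤ C * ∑ j ∈ Finset.range n, (r⁻¹) ^ j * a j ^ q := by
  have hq0 : 0 < q := by linarith
  set τ := r ^ (1 / q) with hτ
  have hτ0 : 0 < τ := Real.rpow_pos_of_pos hr0 _
  have hτ1 : τ < 1 := Real.rpow_lt_one hr0.le hr1 (by positivity)
  have hτq : τ ^ q = r := by
    rw [hτ, ← Real.rpow_mul hr0.le, one_div_mul_cancel hq0.ne', Real.rpow_one]
  refine ⟨((1 - τ)⁻¹) ^ (q - 1), Real.rpow_pos_of_pos (inv_pos.2 (by linarith)) _, ?_⟩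
  intro n a ha
  rcases Nat.eq_zero_or_pos n with rfl | hn
  · simp [Real.zero_rpow hq0.ne']
  set W := ∑ j ∈ Finset.range n, τ ^ j with hW
  have hW0 : 0 < W := Finset.sum_pos (fun j _ => pow_pos hτ0 j) ⟨0, Finset.mem_range.2 hn⟩
  have hW1 : W ≤ (1 - τ)⁻¹ := by
    rw [← tsum_geometric_of_lt_one hτ0.le hτ1]
    exact (summable_geometric_of_lt_one hτ0.le hτ1).sum_le_tsum _ fun j _ => by positivity
  have J := Real.rpow_arith_mean_le_arith_mean_rpow (Finset.range n) (fun j => τ ^ j / W)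
    (fun j => a j / τ ^ j) (fun j _ => by positivity)
    (by rw [← Finset.sum_div, div_self hW0.ne'])
    (fun j _ => div_nonneg (ha j) (by positivity)) hq
  have e1 : ∑ j ∈ Finset.range n, τ ^ j / W * (a j / τ ^ j) = (∑ j ∈ Finset.range n, a j) / W := by
    rw [Finset.sum_div]
    refine Finset.sum_congr rfl fun j _ => ?_
    field_simp
  have hsum : 0 ≤ ∑ j ∈ Finset.range n, a j := Finset.sum_nonneg fun j _ => ha j
  rw [e1, Real.div_rpow hsum hW0.le, div_le_iff₀ (Real.rpow_pos_of_pos hW0 _)] at J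
  refine J.trans ?_
  have e2 : ∀ j, τ ^ j / W * (a j / τ ^ j) ^ q ≤ W⁻¹ * ((r⁻¹) ^ j * a j ^ q) := by
    intro j
    rw [Real.div_rpow (ha j) (by positivity), ← Real.rpow_natCast τ j, ← Real.rpow_mul hτ0.le,
      mul_comm (j : ℝ) q, Real.rpow_mul hτ0.le, hτq, Real.rpow_natCast, Real.rpow_natCast, inv_pow]
    have h1 : τ ^ j ≤ 1 := pow_le_one₀ hτ0.le hτ1.le
    have h2 : 0 ≤ a j ^ q := Real.rpow_nonneg (ha j) _
    calc _ = τ ^ j * (W⁻¹ * ((r ^ j)⁻¹ * a j ^ q)) := by ring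
      _ ≤ 1 * (W⁻¹ * ((r ^ j)⁻¹ * a j ^ q)) := by gcongr
      _ = _ := one_mul _
  calc _ ≤ (∑ j ∈ Finset.range n, W⁻¹ * ((r⁻¹) ^ j * a j ^ q)) * W ^ q := by
        exact mul_le_mul_of_nonneg_right (Finset.sum_le_sum fun j _ => e2 j)
          (Real.rpow_nonneg hW0.le _)
    _ = W ^ (q - 1) * ∑ j ∈ Finset.range n, (r⁻¹) ^ j * a j ^ q := by
        rw [← Finset.mul_sum, Real.rpow_sub_one hW0.ne']; ring
    _ ≤ _ := by
        gcongr
        exact Finset.sum_nonneg fun j _ => mul_nonneg (by positivity) (Real.rpow_nonneg (ha j) _)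

lemma sum_geometric_le {r : ℝ} (hr0 : 0 ≤ r) (hr1 : r < 1) (n : ℕ) :
    ∑ j ∈ Finset.range n, r ^ j ≤ (1 - r)⁻¹ := by
  rw [← tsum_geometric_of_lt_one hr0 hr1]
  exact (summable_geometric_of_lt_one hr0 hr1).sum_le_tsum _ fun j _ => by positivity

/-- The potential `‖f‖^r_{L^r_h} = h² ∑_x |f(x)|^r`. -/
noncomputable def potential {M : ℕ} (r : ℝ) (f : Lattice 2 M → ℂ) [NeZero M] : ℝ :=
  meshSize M ^ 2 * ∑ x, ‖f x‖ ^ r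

lemma rpow_eq_rpow_mul_sq {x r : ℝ} (hx : 0 ≤ x) (hr : 2 ≤ r) : x ^ r = x ^ (r - 2) * x ^ 2 := by
  rw [← Real.rpow_natCast x 2, ← Real.rpow_add_of_nonneg hx (by linarith) (by norm_num)]
  congr 1; push_cast; ring

/-- Gagliardo-Nirenberg inequality on the lattice, uniform in the mesh size. The loss `η > 0` makes
the sum over the dyadic shells converge. -/
lemma exists_potential_le {r η : ℝ} (hr : 2 ≤ r) (hη0 : 0 < η) (hη1 : η ≤ 1) :
    ∃ C : ℝ, 0 < C ∧ ∀ (M : ℕ) [NeZero M] (f : Lattice 2 M → ℂ),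
      potential r f ≤ C * (sobolevNorm 1 f ^ (r - 2) * (sobolevNorm 1 f ^ 2) ^ η *
        mass f ^ (1 - η)) := by
  set ρ : ℝ := (2⁻¹ : ℝ) ^ η with hρ
  have hρ0 : 0 < ρ := Real.rpow_pos_of_pos (by norm_num) _
  have hρ1 : ρ < 1 := Real.rpow_lt_one (by norm_num) (by norm_num) hη0
  obtain ⟨C, hC, hJ⟩ := exists_rpow_sum_le hρ0 hρ1 (by linarith : 1 ≤ r)
  refine ⟨C * 5 ^ (r - 2) * (1 - ρ)⁻¹, by
    have : 0 < 1 - ρ := by linarith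
    positivity, ?_⟩
  intro M _ f
  set A := sobolevNorm 1 f with hA
  have hA0 : 0 ≤ A := sobolevNorm_nonneg 1 f
  have hh := meshSize_pos M
  have hm := mass_nonneg f
  have pc : ∀ j, meshSize M ^ 2 * ∑ x, ‖piece f j x‖ ^ r ≤
      (5 ^ (r - 2) * A ^ (r - 2)) * ((ρ ^ 2) ^ j * ((A ^ 2) ^ η * mass f ^ (1 - η))) := by
    intro j
    have h1 : meshSize M ^ 2 * ∑ x, ‖piece f j x‖ ^ r ≤
        (5 ^ (r - 2) * A ^ (r - 2)) * mass (piece f j) := by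
      unfold mass
      rw [mul_left_comm]
      refine mul_le_mul_of_nonneg_left ?_ (by positivity)
      rw [Finset.mul_sum]
      refine Finset.sum_le_sum fun x _ => ?_
      rw [rpow_eq_rpow_mul_sq (norm_nonneg _) hr, ← Real.mul_rpow (by norm_num) hA0]
      exact mul_le_mul_of_nonneg_right (Real.rpow_le_rpow (norm_nonneg _) (norm_piece_le f j x)
        (by linarith)) (sq_nonneg _)
    refine h1.trans ?_
    gcongr
    have hm0 := mass_nonneg (piece f j)
    calc mass (piece f j) = mass (piece f j) ^ η * mass (piece f j) ^ (1 - η) := by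
          rw [← Real.rpow_add' hm0 (by rw [add_sub_cancel]; norm_num), add_sub_cancel,
            Real.rpow_one]
      _ ≤ ((4 ^ j)⁻¹ * A ^ 2) ^ η * mass f ^ (1 - η) := by
          exact mul_le_mul (Real.rpow_le_rpow hm0 (mass_piece_le_sobolev f j) hη0.le)
            (Real.rpow_le_rpow hm0 (mass_piece_le f j) (by linarith)) (by positivity)
            (by positivity)
      _ = _ := by
          rw [Real.mul_rpow (by positivity) (by positivity), mul_assoc]
          congr 1
          have : ((4 : ℝ) ^ j)⁻¹ = (2⁻¹ : ℝ) ^ ((2 * j : ℕ) : ℝ) := by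
            rw [Real.rpow_natCast, pow_mul, ← inv_pow]; norm_num
          rw [this, ← Real.rpow_mul (by norm_num), mul_comm _ η, Real.rpow_mul (by norm_num),
            Real.rpow_natCast, pow_mul]
  set B := (5 ^ (r - 2) * A ^ (r - 2)) * ((A ^ 2) ^ η * mass f ^ (1 - η)) with hB
  have hB0 : 0 ≤ B := by positivity
  calc potential r f ≤ meshSize M ^ 2 * ∑ x, C * ∑ j ∈ Finset.range (M + 1),
        (ρ⁻¹) ^ j * ‖piece f j x‖ ^ r := by
        unfold potential
        gcongr with x _
        refine le_trans ?_ (hJ (M + 1) (fun j => ‖piece f j x‖) fun j => norm_nonneg _)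
        gcongr
        conv_lhs => rw [sum_piece f x]
        exact norm_sum_le _ _
    _ = C * ∑ j ∈ Finset.range (M + 1), (ρ⁻¹) ^ j * (meshSize M ^ 2 * ∑ x, ‖piece f j x‖ ^ r) := by
        rw [← Finset.mul_sum, Finset.sum_comm, mul_left_comm, Finset.mul_sum]
        congr 1
        refine Finset.sum_congr rfl fun j _ => ?_
        rw [← Finset.mul_sum]; ring
    _ ≤ C * ∑ j ∈ Finset.range (M + 1), (ρ⁻¹) ^ j * ((5 ^ (r - 2) * A ^ (r - 2)) *
          ((ρ ^ 2) ^ j * ((A ^ 2) ^ η * mass f ^ (1 - η)))) := by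
        exact mul_le_mul_of_nonneg_left (Finset.sum_le_sum fun j _ =>
          mul_le_mul_of_nonneg_left (pc j) (by positivity)) hC.le
    _ = C * ((∑ j ∈ Finset.range (M + 1), ρ ^ j) * B) := by
        rw [Finset.sum_mul]
        congr 1
        refine Finset.sum_congr rfl fun j _ => ?_
        have : (ρ ^ 2) ^ j = ρ ^ j * ρ ^ j := by ring
        rw [this, inv_pow, hB]
        field_simp
    _ ≤ C * ((1 - ρ)⁻¹ * B) := by gcongr; exact sum_geometric_le hρ0.le hρ1 _
    _ = _ := by rw [hB]; ring

/-! ### The nonlinearity -/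

/-- The power nonlinearity `|z|^(p-1) z`. -/
noncomputable def nonlin (p : ℝ) (z : ℂ) : ℂ := ((‖z‖ ^ (p - 1) : ℝ) : ℂ) * z

lemma norm_nonlin {p : ℝ} (z : ℂ) : ‖nonlin p z‖ = ‖z‖ ^ (p - 1) * ‖z‖ := by
  unfold nonlin
  rw [norm_mul, Complex.norm_real, Real.norm_eq_abs, abs_of_nonneg (by positivity)]

lemma continuous_nonlin {p : ℝ} (hp : 1 < p) : Continuous (nonlin p) := by
  unfold nonlin
  exact (Complex.continuous_ofReal.comp
    (continuous_norm.rpow_const fun _ => Or.inr (by linarith))).mul continuous_id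

lemma norm_nonlin_sub_le_of_le {p : ℝ} (hp : 1 < p) {a b : ℂ} (hab : ‖a‖ ≤ ‖b‖) :
    ‖nonlin p a - nonlin p b‖ ≤ (p + 1) * ‖b‖ ^ (p - 1) * ‖a - b‖ := by
  set x := ‖a‖ with hx
  set y := ‖b‖ with hy
  have hx0 : 0 ≤ x := norm_nonneg a
  have hy0 : 0 ≤ y := norm_nonneg b
  have h1 : nonlin p a - nonlin p b = ((x ^ (p - 1) : ℝ) : ℂ) * (a - b) -
      ((y ^ (p - 1) - x ^ (p - 1) : ℝ) : ℂ) * b := by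
    unfold nonlin; push_cast; ring
  have hmono : x ^ (p - 1) ≤ y ^ (p - 1) := Real.rpow_le_rpow hx0 hab (by linarith)
  have h2 : ‖nonlin p a - nonlin p b‖ ≤
      x ^ (p - 1) * ‖a - b‖ + (y ^ (p - 1) - x ^ (p - 1)) * y := by
    rw [h1]
    refine (norm_sub_le _ _).trans ?_
    rw [norm_mul, norm_mul, Complex.norm_real, Complex.norm_real, Real.norm_eq_abs,
      Real.norm_eq_abs, abs_of_nonneg (by positivity), abs_of_nonneg (sub_nonneg.2 hmono)]
  have hyx : y - x ≤ ‖a - b‖ := by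
    rw [norm_sub_rev]; exact norm_sub_norm_le b a
  -- the tangent line of `s ↦ s ^ p` at `y`
  have h3 : (y ^ (p - 1) - x ^ (p - 1)) * y ≤ p * y ^ (p - 1) * (y - x) := by
    rcases hy0.eq_or_lt with h0 | h0
    · have : x = 0 := le_antisymm (h0 ▸ hab) hx0
      rw [this, ← h0]; simp
    · have hb := one_add_mul_self_le_rpow_one_add (s := x / y - 1)
        (by have : 0 ≤ x / y := by positivity
            linarith) hp.le
      rw [add_sub_cancel, Real.div_rpow hx0 hy0, le_div_iff₀ (by positivity)] at hb
      have e1 : y ^ p = y ^ (p - 1) * y := by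
        rw [← Real.rpow_add_one h0.ne', sub_add_cancel]
      have e2 : x ^ p ≤ x ^ (p - 1) * y := by
        have : x ^ p = x ^ (p - 1) * x := by
          rw [← Real.rpow_add_one' hx0 (by linarith), sub_add_cancel]
        rw [this]; gcongr
      have e3 : (1 + p * (x / y - 1)) * y ^ p = y ^ (p - 1) * y - p * y ^ (p - 1) * (y - x) := by
        rw [e1]; field_simp; ring
      rw [e3] at hb
      linarith
  have hy1 : 0 ≤ y ^ (p - 1) := by positivity
  calc _ ≤ _ := h2
    _ ≤ y ^ (p - 1) * ‖a - b‖ + p * y ^ (p - 1) * ‖a - b‖ := by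
        exact add_le_add (by gcongr) (h3.trans (by gcongr))
    _ = _ := by ring

lemma norm_nonlin_sub_le {p B : ℝ} (hp : 1 < p) {a b : ℂ} (ha : ‖a‖ ≤ B) (hb : ‖b‖ ≤ B) :
    ‖nonlin p a - nonlin p b‖ ≤ (p + 1) * B ^ (p - 1) * ‖a - b‖ := by
  rcases le_total ‖a‖ ‖b‖ with h | h
  · refine (norm_nonlin_sub_le_of_le hp h).trans ?_
    gcongr
  · rw [norm_sub_rev, norm_sub_rev a b]
    refine (norm_nonlin_sub_le_of_le hp h).trans ?_
    gcongr

/-- The nonlinearity acts on `H¹_h`, with the sup norm as multiplier. -/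
lemma sobolevNorm_nonlin_sq_le {p : ℝ} (hp : 1 < p) {M : ℕ} [NeZero M] (f : Lattice 2 M → ℂ) :
    sobolevNorm 1 (fun x => nonlin p (f x)) ^ 2 ≤
      3 * (p + 1) ^ 2 * ‖f‖ ^ (2 * p - 2) * sobolevNorm 1 f ^ 2 := by
  have hh := meshSize_pos M
  set B := ‖f‖ with hB
  have hB0 : 0 ≤ B := norm_nonneg f
  have hBp : B ^ (2 * p - 2) = (B ^ (p - 1)) ^ 2 := by
    rw [← Real.rpow_natCast, ← Real.rpow_mul hB0]; congr 1; push_cast; ring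
  have hle : ∀ x, ‖f x‖ ≤ B := norm_le_pi_norm f
  have h1 : mass (fun x => nonlin p (f x)) ≤ ((p + 1) * B ^ (p - 1)) ^ 2 * mass f := by
    unfold mass
    rw [mul_left_comm, Finset.mul_sum _ _ (((p + 1) * B ^ (p - 1)) ^ 2)]
    gcongr with x _
    rw [← mul_pow, norm_nonlin]
    gcongr
    have : ‖f x‖ ^ (p - 1) ≤ B ^ (p - 1) := Real.rpow_le_rpow (norm_nonneg _) (hle x) (by linarith)
    have h0 : 0 ≤ B ^ (p - 1) := by positivity
    nlinarith
  have h2 : kinetic (fun x => nonlin p (f x)) ≤ ((p + 1) * B ^ (p - 1)) ^ 2 * kinetic f := by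
    unfold kinetic
    rw [mul_left_comm, Finset.mul_sum _ _ (((p + 1) * B ^ (p - 1)) ^ 2)]
    gcongr with x _
    rw [Finset.mul_sum]
    gcongr with j _
    rw [← mul_div_assoc, ← mul_pow]
    gcongr
    exact norm_nonlin_sub_le hp (hle _) (hle _)
  have h3 := mass_add_kinetic_le f
  refine (sobolevNorm_sq_le _).trans ?_
  calc _ ≤ 3 * (((p + 1) * B ^ (p - 1)) ^ 2 * (mass f + kinetic f)) := by linarith
    _ ≤ 3 * (((p + 1) * B ^ (p - 1)) ^ 2 * sobolevNorm 1 f ^ 2) := by gcongr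
    _ = _ := by rw [hBp]; ring

/-! ### Solutions in Fourier variables -/

lemma IsSolution.hasDerivAt {d M : ℕ} {lam p : ℝ} {u : ℝ → Lattice d M → ℂ}
    (hu : IsSolution lam p u) (t : ℝ) (x : Lattice d M) :
    HasDerivAt (fun s => u s x) (Complex.I * discreteLaplacian (u t) x +
      (-Complex.I * lam) * nonlin p (u t x)) t := by
  obtain ⟨h1, h2⟩ := hu t x
  have h := h1.hasDerivAt
  have e : deriv (fun s => u s x) t = Complex.I * discreteLaplacian (u t) x +
      (-Complex.I * lam) * nonlin p (u t x) := by
    unfold nonlin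
    linear_combination (-Complex.I) * h2 + deriv (fun s => u s x) t * Complex.I_mul_I
  rwa [e] at h

lemma IsSolution.continuous {d M : ℕ} {lam p : ℝ} {u : ℝ → Lattice d M → ℂ}
    (hu : IsSolution lam p u) : Continuous u :=
  continuous_pi fun x => continuous_iff_continuousAt.2 fun t => (hu.hasDerivAt t x).continuousAt

lemma continuous_fourier {d M : ℕ} [NeZero M] {u : ℝ → Lattice d M → ℂ} (hu : Continuous u)
    (k : Fin d → ℤ) : Continuous fun t => fourier (u t) k := by
  simp_rw [fourier_eq]
  exact continuous_const.mul (continuous_finsetSum _ fun x _ =>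
    ((continuous_apply x).comp hu).mul continuous_const)

lemma continuous_sobolevNorm_sq {d M : ℕ} [NeZero M] {u : ℝ → Lattice d M → ℂ}
    (hu : Continuous u) : Continuous fun t => sobolevNorm 1 (u t) ^ 2 := by
  have e : (fun t => sobolevNorm 1 (u t) ^ 2) = fun t => ((2 * Real.pi) ^ d)⁻¹ *
      ∑ k ∈ frequencies d M, (1 + ∑ j, (k j : ℝ) ^ 2) * ‖fourier (u t) k‖ ^ 2 := by
    funext t
    rw [← sobolevNorm_one_sq, inv_mul_cancel_left₀ (by positivity)]
  rw [e]
  exact continuous_const.mul (continuous_finsetSum _ fun k _ =>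
    continuous_const.mul ((continuous_fourier hu k).norm.pow 2))

lemma IsSolution.continuous_nonlin {d M : ℕ} {lam p : ℝ} {u : ℝ → Lattice d M → ℂ}
    (hu : IsSolution lam p u) (hp : 1 < p) : Continuous fun t x => nonlin p (u t x) :=
  continuous_pi fun x => (DNLS.continuous_nonlin hp).comp ((continuous_apply x).comp hu.continuous)

/-- The Fourier coefficients in the interaction picture: conjugating by the free evolution leaves
only the nonlinear term. -/
lemma IsSolution.hasDerivAt_profile {d M : ℕ} [NeZero M] {lam p : ℝ} {u : ℝ → Lattice d M → ℂ}
    (hu : IsSolution lam p u) (k : Fin d → ℤ) (t : ℝ) :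
    HasDerivAt (fun t : ℝ => Complex.exp (t * laplaceSymbol M k * Complex.I) * fourier (u t) k)
      (Complex.exp (t * laplaceSymbol M k * Complex.I) *
        ((-Complex.I * lam) * fourier (fun x => nonlin p (u t x)) k)) t := by
  have h1 : HasDerivAt (fun t => fourier (u t) k)
      (fourier (fun x => Complex.I * discreteLaplacian (u t) x +
        (-Complex.I * lam) * nonlin p (u t x)) k) t := by
    simp_rw [fourier_eq]
    exact (HasDerivAt.fun_sum fun x _ => (hu.hasDerivAt t x).mul_const _).const_mul _
  rw [fourier_add, fourier_const_mul, fourier_const_mul, fourier_discreteLaplacian] at h1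
  have h2 : HasDerivAt (fun t : ℝ => Complex.exp (t * laplaceSymbol M k * Complex.I))
      (Complex.exp (t * laplaceSymbol M k * Complex.I) *
        (1 * laplaceSymbol M k * Complex.I)) t :=
    (((hasDerivAt_id t).ofReal_comp.mul_const _).mul_const _).cexp
  exact (h2.mul h1).congr_deriv (by ring)

/-- The dispersive kernel of one dyadic box of frequencies. -/
lemma exists_dyadic_kernel {ρ : ℝ} (hρ1 : 1 ≤ ρ) (hρ : ρ ^ 4 = 2) (M : ℕ) [NeZero M] (j : ℕ) :
    ∃ κ : ℝ → ℝ, Continuous κ ∧ (∫ t in (-1 : ℝ)..1, κ t) ≤ 412 * (ρ ^ (j + 1)) ^ 7 ∧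
      ∀ (t : ℝ) (x y : Lattice 2 M),
        ‖∑ k ∈ Fintype.piFinset fun _ => dyadicInterval M j, wave k x * conj (wave k y) *
          Complex.exp (-(t * laplaceSymbol M k) * Complex.I)‖ ≤ κ t := by
  obtain ⟨κ, h1, h2, h3⟩ := exists_kernel_bound (M := M) (N := min (2 ^ (j + 1)) M)
    (c := ρ ^ (j + 1)) (J := dyadicInterval M j) (NeZero.pos M) (min_le_right _ _)
    (one_le_pow₀ hρ1) (by
      rw [← pow_mul, mul_comm, pow_mul, hρ]
      exact_mod_cast min_le_left _ _) (by
      intro k hk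
      obtain ⟨ha, hb⟩ := Finset.mem_filter.1 hk
      have hc := Finset.mem_Ico.1 ha
      rw [Int.abs_eq_natAbs]
      have : k.natAbs ≤ min (2 ^ (j + 1)) M := le_min hb (by omega)
      exact_mod_cast this)
  refine ⟨κ, h1, h2, fun t x y => ?_⟩
  let S : Fin 2 → ℂ := fun i => ∑ k ∈ dyadicInterval M j,
    ZMod.stdAddChar (x i - y i) ^ k * Complex.exp (-(t * symbol M k) * Complex.I)
  have hS : ∀ i, ‖S i‖ ^ 2 ≤ κ t := fun i => h3 t _ (norm_stdAddChar _)
  have e : ∑ k ∈ Fintype.piFinset fun _ => dyadicInterval M j, wave k x * conj (wave k y) *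
      Complex.exp (-(t * laplaceSymbol M k) * Complex.I) = ∏ i, S i := by
    rw [Finset.prod_univ_sum]
    refine Finset.sum_congr rfl fun k _ => ?_
    rw [wave_mul_conj, Finset.prod_mul_distrib]
    congr 1
    · unfold wave
      refine Finset.prod_congr rfl fun i _ => ?_
      rw [← AddChar.map_zsmul_eq_zpow, zsmul_eq_mul, Pi.sub_apply]
    · rw [← Complex.exp_sum]
      congr 1
      unfold laplaceSymbol
      push_cast
      rw [Finset.mul_sum, ← Finset.sum_neg_distrib, Finset.sum_mul]
  rw [e, Fin.prod_univ_two, norm_mul]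
  nlinarith [hS 0, hS 1, sq_nonneg (‖S 0‖ - ‖S 1‖)]

/-- Strichartz estimate for one Littlewood-Paley piece of a solution: a gain `ρ^{-j} = 2^{-j/4}`
over Bernstein's inequality. -/
lemma IsSolution.integral_norm_piece_sq_le {ρ : ℝ} (hρ1 : 1 ≤ ρ) (hρ : ρ ^ 4 = 2) {M : ℕ}
    [NeZero M] {lam p : ℝ} (hlam : |lam| = 1) (hp : 1 < p) {u : ℝ → Lattice 2 M → ℂ}
    (hu : IsSolution lam p u) (j : ℕ) :
    ∫ t in (0 : ℝ)..1, ‖piece (u t) j‖ ^ 2 ≤ 3296 * (ρ ^ j)⁻¹ * (sobolevNorm 1 (u 0) ^ 2 +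
      ∫ s in (0 : ℝ)..1, sobolevNorm 1 (fun x => nonlin p (u s x)) ^ 2) := by
  obtain ⟨κ, hκ, hκi, hker⟩ := exists_dyadic_kernel hρ1 hρ M j
  have hnl := hu.continuous_nonlin hp
  set w : ℂ := (((2 * Real.pi : ℝ) : ℂ) ^ 2)⁻¹ with hw
  have hwn : ‖w‖ = ((2 * Real.pi) ^ 2)⁻¹ := by
    rw [hw, norm_inv, norm_pow, Complex.norm_real, Real.norm_eq_abs, abs_of_pos Real.two_pi_pos]
  let c : ℝ → (Fin 2 → ℤ) → ℂ := fun t k => if k ∈ shell M j then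
    w * (Complex.exp (t * laplaceSymbol M k * Complex.I) * fourier (u t) k) else 0
  let c' : ℝ → (Fin 2 → ℤ) → ℂ := fun t k => if k ∈ shell M j then
    w * (Complex.exp (t * laplaceSymbol M k * Complex.I) *
        ((-Complex.I * lam) * fourier (fun x => nonlin p (u t x)) k)) else 0
  have main := integral_norm_sq_le_of_kernel_duhamel (Fintype.piFinset fun _ => dyadicInterval M j)
    (laplaceSymbol M) (fun k x => wave k x) hκ hker c c' (by
      intro k _ t
      by_cases hk : k ∈ shell M j
      · simp only [c, c', if_pos hk]
        exact (hu.hasDerivAt_profile k t).const_mul w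
      · simp only [c, c', if_neg hk]
        exact hasDerivAt_const t 0) (by
      intro k _
      by_cases hk : k ∈ shell M j
      · simp only [c', if_pos hk]
        have := continuous_fourier hnl k
        fun_prop
      · simp only [c', if_neg hk]
        exact continuous_const)
  have sum_ite : ∀ F x : (Fin 2 → ℤ) → ℂ, ∑ k ∈ Fintype.piFinset fun _ => dyadicInterval M j,
      (if k ∈ shell M j then F k else 0) * x k = ∑ k ∈ shell M j, F k * x k := by
    intro F x
    rw [← Finset.sum_subset (shell_subset_box M j)]
    · exact Finset.sum_congr rfl fun k hk => by rw [if_pos hk]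
    · intro k _ hk; rw [if_neg hk, zero_mul]
  have sum_ite_sq : ∀ F : (Fin 2 → ℤ) → ℂ, ∑ k ∈ Fintype.piFinset fun _ => dyadicInterval M j,
      ‖if k ∈ shell M j then F k else 0‖ ^ 2 = ∑ k ∈ shell M j, ‖F k‖ ^ 2 := by
    intro F
    rw [← Finset.sum_subset (shell_subset_box M j)]
    · exact Finset.sum_congr rfl fun k hk => by rw [if_pos hk]
    · intro k _ hk; simp [if_neg hk]
  have nexp : ∀ (t : ℝ) (k : Fin 2 → ℤ), ‖Complex.exp (t * laplaceSymbol M k * Complex.I)‖ = 1 := by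
    intro t k
    have := Complex.norm_exp_ofReal_mul_I (t * laplaceSymbol M k)
    push_cast at this
    exact this
  have lhs : ∀ t : ℝ, (fun x => ∑ k ∈ Fintype.piFinset fun _ => dyadicInterval M j,
      c t k * (wave k x * Complex.exp (-(t * laplaceSymbol M k) * Complex.I))) = piece (u t) j := by
    intro t
    funext x
    simp only [c]
    rw [sum_ite]
    unfold piece
    rw [Finset.mul_sum]
    refine Finset.sum_congr rfl fun k _ => ?_
    have : Complex.exp (t * laplaceSymbol M k * Complex.I) *
        Complex.exp (-(t * laplaceSymbol M k) * Complex.I) = 1 := by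
      rw [← Complex.exp_add, ← Complex.exp_zero]; congr 1; ring
    rw [← hw]
    linear_combination (w * fourier (u t) k * wave k x) * this
  simp_rw [lhs] at main
  -- a sum over the shell costs `4^{-j}` in terms of the Sobolev norm
  have shellsum : ∀ f : Lattice 2 M → ℂ, ‖w‖ ^ 2 * ∑ k ∈ shell M j, ‖fourier f k‖ ^ 2 ≤
      (4 ^ j)⁻¹ * sobolevNorm 1 f ^ 2 := by
    intro f
    have h := sum_shell_norm_fourier_sq_le f j
    have hpi : 1 ≤ (2 * Real.pi) ^ 2 := by nlinarith [Real.pi_gt_three]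
    rw [hwn, inv_mul_eq_div, le_div_iff₀ (by positivity)]
    calc _ = ((2 * Real.pi) ^ 2)⁻¹ * (((2 * Real.pi) ^ 2)⁻¹ *
          (4 ^ j * ∑ k ∈ shell M j, ‖fourier f k‖ ^ 2)) := by ring
      _ ≤ ((2 * Real.pi) ^ 2)⁻¹ * (((2 * Real.pi) ^ 2)⁻¹ *
          ((2 * Real.pi) ^ 2 * sobolevNorm 1 f ^ 2)) := by gcongr
      _ = ((2 * Real.pi) ^ 2)⁻¹ * sobolevNorm 1 f ^ 2 := by
          rw [inv_mul_cancel_left₀ (by positivity)]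
      _ ≤ 1 * sobolevNorm 1 f ^ 2 := by gcongr; exact inv_le_one_of_one_le₀ hpi
      _ = _ := one_mul _
  have hc0 : ∑ k ∈ Fintype.piFinset fun _ => dyadicInterval M j, ‖c 0 k‖ ^ 2 ≤
      (4 ^ j)⁻¹ * sobolevNorm 1 (u 0) ^ 2 := by
    simp only [c]
    rw [sum_ite_sq]
    simp_rw [norm_mul, nexp, one_mul, mul_pow]
    rw [← Finset.mul_sum]
    exact shellsum _
  have hcs : ∀ s, ∑ k ∈ Fintype.piFinset fun _ => dyadicInterval M j, ‖c' s k‖ ^ 2 ≤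
      (4 ^ j)⁻¹ * sobolevNorm 1 (fun x => nonlin p (u s x)) ^ 2 := by
    intro s
    simp only [c']
    rw [sum_ite_sq]
    simp_rw [norm_mul, nexp, one_mul, norm_neg, Complex.norm_I, Complex.norm_real,
      Real.norm_eq_abs, hlam, one_mul, mul_pow]
    rw [← Finset.mul_sum]
    exact shellsum _
  have hci : ∫ s in (0 : ℝ)..1, ∑ k ∈ Fintype.piFinset fun _ => dyadicInterval M j, ‖c' s k‖ ^ 2 ≤
      (4 ^ j)⁻¹ * ∫ s in (0 : ℝ)..1, sobolevNorm 1 (fun x => nonlin p (u s x)) ^ 2 := by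
    rw [← intervalIntegral.integral_const_mul]
    refine intervalIntegral.integral_mono_on zero_le_one (Continuous.intervalIntegrable ?_ _ _)
      (((continuous_sobolevNorm_sq hnl).const_mul _).intervalIntegrable _ _) fun s _ => hcs s
    refine continuous_finsetSum _ fun k _ => Continuous.pow (Continuous.norm ?_) 2
    by_cases hk : k ∈ shell M j
    · simp only [c', if_pos hk]
      have := continuous_fourier hnl k
      fun_prop
    · simp only [c', if_neg hk]
      exact continuous_const
  have hI : 0 ≤ ∫ s in (0 : ℝ)..1, sobolevNorm 1 (fun x => nonlin p (u s x)) ^ 2 :=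
    intervalIntegral.integral_nonneg zero_le_one fun _ _ => sq_nonneg _
  refine main.trans ?_
  calc _ ≤ 2 * (412 * (ρ ^ (j + 1)) ^ 7) * ((4 ^ j)⁻¹ * sobolevNorm 1 (u 0) ^ 2 +
      (4 ^ j)⁻¹ * ∫ s in (0 : ℝ)..1, sobolevNorm 1 (fun x => nonlin p (u s x)) ^ 2) := by
        gcongr
        exact add_nonneg (Finset.sum_nonneg fun _ _ => sq_nonneg _)
          (intervalIntegral.integral_nonneg zero_le_one fun _ _ =>
            Finset.sum_nonneg fun _ _ => sq_nonneg _)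
    _ = 824 * ((ρ ^ (j + 1)) ^ 7 * (4 ^ j)⁻¹) * (sobolevNorm 1 (u 0) ^ 2 +
      ∫ s in (0 : ℝ)..1, sobolevNorm 1 (fun x => nonlin p (u s x)) ^ 2) := by ring
    _ ≤ 824 * (4 * (ρ ^ j)⁻¹) * (sobolevNorm 1 (u 0) ^ 2 +
      ∫ s in (0 : ℝ)..1, sobolevNorm 1 (fun x => nonlin p (u s x)) ^ 2) := by
        have h8 : ρ ^ 8 = 4 := by rw [show ρ ^ 8 = (ρ ^ 4) ^ 2 by ring, hρ]; norm_num
        have h7 : ρ ^ 7 ≤ 4 := by rw [← h8]; exact pow_le_pow_right₀ hρ1 (by norm_num)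
        have e : (ρ ^ (j + 1)) ^ 7 * (4 ^ j)⁻¹ = ρ ^ 7 * (ρ ^ j)⁻¹ := by
          have : ρ ≠ 0 := by positivity
          rw [← h8]; field_simp; ring
        rw [e]
        gcongr
    _ = _ := by ring

/-! ### Conservation laws and the uniform `H¹` bound -/

/-- Summation by parts on the periodic lattice. -/
lemma sum_conj_mul_discreteLaplacian {d M : ℕ} [NeZero M] (f g : Lattice d M → ℂ) :
    ∑ x, conj (f x) * discreteLaplacian g x =
      -∑ x, ∑ j : Fin d, conj (f (x + Pi.single j 1) - f x) * (g (x + Pi.single j 1) - g x) /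
        ((meshSize M : ℝ) : ℂ) ^ 2 := by
  unfold discreteLaplacian
  simp_rw [Finset.mul_sum]
  conv_lhs => rw [Finset.sum_comm]
  conv_rhs => rw [Finset.sum_comm]
  rw [← Finset.sum_neg_distrib]
  refine Finset.sum_congr rfl fun j _ => ?_
  simp_rw [← mul_div_assoc]
  rw [← Finset.sum_div, ← Finset.sum_div, ← neg_div]
  congr 1
  set e : Lattice d M := Pi.single j 1
  have h1 : ∑ x, conj (f (x + e)) * g (x + e) = ∑ x, conj (f x) * g x :=
    Equiv.sum_comp (Equiv.addRight e) (fun x => conj (f x) * g x)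
  have h2 : ∑ x, conj (f (x + e)) * g x = ∑ x, conj (f x) * g (x - e) := by
    rw [← Equiv.sum_comp (Equiv.addRight e) (fun x => conj (f x) * g (x - e))]
    simp
  have h3 : ∑ x, conj (f x) * (g (x + e) + g (x - e) - 2 * g x) =
      ∑ x, conj (f x) * g (x + e) + ∑ x, conj (f x) * g (x - e) - 2 * ∑ x, conj (f x) * g x := by
    rw [Finset.mul_sum, ← Finset.sum_add_distrib, ← Finset.sum_sub_distrib]
    exact Finset.sum_congr rfl fun x _ => by ring
  have h4 : ∑ x, conj (f (x + e) - f x) * (g (x + e) - g x) =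
      ∑ x, conj (f (x + e)) * g (x + e) - ∑ x, conj (f (x + e)) * g x -
        ∑ x, conj (f x) * g (x + e) + ∑ x, conj (f x) * g x := by
    rw [← Finset.sum_sub_distrib, ← Finset.sum_sub_distrib, ← Finset.sum_add_distrib]
    exact Finset.sum_congr rfl fun x _ => by rw [map_sub]; ring
  rw [h3, h4, h1, h2]
  ring

/-- The mass is conserved. -/
lemma IsSolution.mass_eq {M : ℕ} [NeZero M] {lam p : ℝ} {u : ℝ → Lattice 2 M → ℂ}
    (hu : IsSolution lam p u) (t : ℝ) : mass (u t) = mass (u 0) := by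
  have key : ∀ t, HasDerivAt (fun t => mass (u t)) 0 t := by
    intro t
    have h1 : HasDerivAt (fun t => mass (u t)) (meshSize M ^ 2 * ∑ x, 2 * inner ℝ (u t x)
        (Complex.I * discreteLaplacian (u t) x + (-Complex.I * lam) * nonlin p (u t x))) t := by
      unfold mass
      exact (HasDerivAt.fun_sum fun x _ => (hu.hasDerivAt t x).norm_sq).const_mul _
    convert h1 using 1
    have h2 : ∀ x, (2 * inner ℝ (u t x) (Complex.I * discreteLaplacian (u t) x +
        (-Complex.I * lam) * nonlin p (u t x)) : ℝ) =
        -2 * (conj (u t x) * discreteLaplacian (u t) x).im := by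
      intro x
      rw [Complex.inner, nonlin]
      simp
      ring
    simp_rw [h2]
    rw [← Finset.mul_sum, ← Complex.im_sum, sum_conj_mul_discreteLaplacian]
    have h3 : ∀ x j, conj (u t (x + Pi.single j 1) - u t x) * (u t (x + Pi.single j 1) - u t x) /
        ((meshSize M : ℝ) : ℂ) ^ 2 =
        ((‖u t (x + Pi.single j 1) - u t x‖ ^ 2 / meshSize M ^ 2 : ℝ) : ℂ) := by
      intro x j
      rw [mul_comm, Complex.mul_conj, Complex.normSq_eq_norm_sq]
      push_cast; rfl
    simp_rw [h3, ← Complex.ofReal_sum, ← Complex.ofReal_neg, Complex.ofReal_im]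
    simp
  exact is_const_of_deriv_eq_zero (fun t => (key t).differentiableAt) (fun t => (key t).deriv) t 0

lemma hasDerivAt_norm_rpow_add_one {p : ℝ} (hp : 1 < p) {f : ℝ → ℂ} {f' : ℂ} {t : ℝ}
    (hf : HasDerivAt f f' t) : HasDerivAt (fun t => ‖f t‖ ^ (p + 1))
      ((p + 1) * (conj f' * nonlin p (f t)).re) t := by
  have h := (hf.norm_sq).rpow_const (p := (p + 1) / 2) (Or.inr (by linarith))
  have e1 : (fun t => ‖f t‖ ^ (p + 1)) = fun t => (‖f t‖ ^ 2) ^ ((p + 1) / 2) := by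
    funext s
    rw [← Real.rpow_natCast, ← Real.rpow_mul (norm_nonneg _)]
    congr 1; push_cast; ring
  have e2 : (‖f t‖ ^ 2) ^ ((p + 1) / 2 - 1) = ‖f t‖ ^ (p - 1) := by
    rw [← Real.rpow_natCast, ← Real.rpow_mul (norm_nonneg _)]
    congr 1; push_cast; ring
  rw [e1]
  convert h using 1
  rw [e2, Complex.inner, nonlin]
  simp
  ring

/-- The energy is conserved. -/
lemma IsSolution.energy_eq {M : ℕ} [NeZero M] {lam p : ℝ} (hp : 1 < p) {u : ℝ → Lattice 2 M → ℂ}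
    (hu : IsSolution lam p u) (t : ℝ) :
    kinetic (u t) + 2 * lam / (p + 1) * potential (p + 1) (u t) =
      kinetic (u 0) + 2 * lam / (p + 1) * potential (p + 1) (u 0) := by
  have key : ∀ t, HasDerivAt (fun t => kinetic (u t) + 2 * lam / (p + 1) *
      potential (p + 1) (u t)) 0 t := by
    intro t
    set v : Lattice 2 M → ℂ := fun x => Complex.I * discreteLaplacian (u t) x +
      (-Complex.I * lam) * nonlin p (u t x) with hv
    have hd : ∀ x, HasDerivAt (fun s => u s x) (v x) t := hu.hasDerivAt t
    have h1 : HasDerivAt (fun t => kinetic (u t)) (meshSize M ^ 2 * ∑ x, ∑ j : Fin 2,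
        2 * inner ℝ (u t (x + Pi.single j 1) - u t x) (v (x + Pi.single j 1) - v x) /
          meshSize M ^ 2) t := by
      unfold kinetic
      exact (HasDerivAt.fun_sum fun x _ => HasDerivAt.fun_sum fun j _ =>
        (((hd _).sub (hd x)).norm_sq).div_const _).const_mul _
    have h2 : HasDerivAt (fun t => potential (p + 1) (u t)) (meshSize M ^ 2 * ∑ x,
        (p + 1) * (conj (v x) * nonlin p (u t x)).re) t := by
      unfold potential
      exact (HasDerivAt.fun_sum fun x _ => hasDerivAt_norm_rpow_add_one hp (hd x)).const_mul _
    refine (h1.fun_add (h2.const_mul (2 * lam / (p + 1)))).congr_deriv ?_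
    have h3 : ∑ x, ∑ j : Fin 2, (2 * inner ℝ (u t (x + Pi.single j 1) - u t x)
        (v (x + Pi.single j 1) - v x) / meshSize M ^ 2 : ℝ) =
        -2 * (∑ x, conj (v x) * discreteLaplacian (u t) x).re := by
      rw [sum_conj_mul_discreteLaplacian, Complex.neg_re, Complex.re_sum, neg_mul_neg,
        Finset.mul_sum]
      refine Finset.sum_congr rfl fun x _ => ?_
      rw [Complex.re_sum, Finset.mul_sum]
      refine Finset.sum_congr rfl fun j _ => ?_
      rw [Complex.inner, ← Complex.ofReal_pow, Complex.div_ofReal_re]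
      simp only [Complex.mul_re, Complex.conj_re, Complex.conj_im]
      ring
    rw [h3, ← Finset.mul_sum]
    have h4 : ∑ x, (conj (v x) * nonlin p (u t x)).re * lam =
        (∑ x, conj (v x) * discreteLaplacian (u t) x).re := by
      rw [Complex.re_sum]
      refine Finset.sum_congr rfl fun x _ => ?_
      -- the equation says `Δ u - λ |u|^(p-1) u = -i u'`, and `conj u' * (-i u')` is imaginary
      have e : conj (v x) * discreteLaplacian (u t) x =
          conj (v x) * nonlin p (u t x) * lam + -Complex.I * (conj (v x) * v x) := by
        have : discreteLaplacian (u t) x = nonlin p (u t x) * lam + -Complex.I * v x := by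
          simp only [hv]
          linear_combination (discreteLaplacian (u t) x - lam * nonlin p (u t x)) *
            Complex.I_mul_I
        rw [this]; ring
      rw [e, mul_comm (conj (v x)) (v x), Complex.mul_conj, Complex.add_re, Complex.re_mul_ofReal]
      simp
    have hp1 : p + 1 ≠ 0 := by linarith
    rw [← h4, ← Finset.sum_mul]
    field_simp
    ring
  exact is_const_of_deriv_eq_zero (fun t => (key t).differentiableAt) (fun t => (key t).deriv) t 0

lemma potential_nonneg {M : ℕ} [NeZero M] (r : ℝ) (f : Lattice 2 M → ℂ) : 0 ≤ potential r f := by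
  unfold potential; positivity

lemma mass_le_sobolevNorm_sq {M : ℕ} [NeZero M] (f : Lattice 2 M → ℂ) :
    mass f ≤ sobolevNorm 1 f ^ 2 := by
  linarith [mass_add_kinetic_le f, kinetic_nonneg f]

lemma exists_sobolevNorm_le_defocusing {p : ℝ} (hp : 1 < p) {R : ℝ} (hR : 0 ≤ R) :
    ∃ C : ℝ, 0 < C ∧ ∀ (M : ℕ) [NeZero M] (u : ℝ → Lattice 2 M → ℂ), IsSolution 1 p u →
      sobolevNorm 1 (u 0) ≤ R → ∀ t, sobolevNorm 1 (u t) ≤ C * sobolevNorm 1 (u 0) := by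
  obtain ⟨C, hC, hS⟩ := exists_potential_le (r := p + 1) (by linarith) one_pos le_rfl
  refine ⟨Real.sqrt (3 * (1 + C * R ^ (p - 1))), by positivity, fun M _ u hu hu0 t => ?_⟩
  set A0 := sobolevNorm 1 (u 0) with hA0
  have hA00 : 0 ≤ A0 := sobolevNorm_nonneg _ _
  have h1 := sobolevNorm_sq_le (u t)
  have h2 := hu.mass_eq t
  have h3 := hu.energy_eq hp t
  have h4 := mass_add_kinetic_le (u 0)
  have h5 := hS M (u 0)
  rw [sub_self, Real.rpow_zero, mul_one, Real.rpow_one, show p + 1 - 2 = p - 1 by ring] at h5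
  have h6 : 2 * 1 / (p + 1) ≤ 1 := by rw [div_le_one (by linarith)]; linarith
  have h7 : 0 ≤ 2 * 1 / (p + 1) := div_nonneg (by norm_num) (by linarith)
  have h8 := mul_nonneg h7 (potential_nonneg (p + 1) (u t))
  have h9 := mul_le_mul_of_nonneg_right h6 (potential_nonneg (p + 1) (u 0))
  have h10 : A0 ^ (p - 1) * A0 ^ 2 ≤ R ^ (p - 1) * A0 ^ 2 := by
    gcongr
  have h11 := mul_le_mul_of_nonneg_left h10 hC.le
  refine abs_le_of_sq_le_sq' ?_ (by positivity) |>.2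
  rw [mul_pow, Real.sq_sqrt (by positivity)]
  calc _ ≤ _ := h1
    _ ≤ 3 * (A0 ^ 2 + C * (R ^ (p - 1) * A0 ^ 2)) := by linarith
    _ = _ := by ring

/-- In the focusing case the Gagliardo-Nirenberg inequality is used with `η = (3 - p) / 4`, which
bounds the potential by `C A^θ A0^θ` with `θ = (p + 1) / 2 < 2`. -/
lemma exists_sobolevNorm_le_focusing {p : ℝ} (hp : 1 < p) (hp3 : p < 3) {R : ℝ} (hR : 0 ≤ R) :
    ∃ C : ℝ, 0 < C ∧ ∀ (M : ℕ) [NeZero M] (u : ℝ → Lattice 2 M → ℂ), IsSolution (-1) p u →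
      sobolevNorm 1 (u 0) ≤ R → ∀ t, sobolevNorm 1 (u t) ≤ C * sobolevNorm 1 (u 0) := by
  set η : ℝ := (3 - p) / 4 with hη
  set θ : ℝ := (p + 1) / 2 with hθ
  obtain ⟨C, hC, hS⟩ := exists_potential_le (r := p + 1) (η := η) (by linarith)
    (by rw [hη]; linarith) (by rw [hη]; linarith)
  have h2θ : 0 < 2 - θ := by rw [hθ]; linarith
  set L : ℝ := (6 * C * R ^ (p - 1) + 1) ^ (1 / (2 - θ)) with hL
  have hL0 : 0 < L := by positivity
  have hLθ : L ^ (2 - θ) = 6 * C * R ^ (p - 1) + 1 := by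
    rw [hL, ← Real.rpow_mul (by positivity), one_div_mul_cancel h2θ.ne', Real.rpow_one]
  refine ⟨max L 3, by positivity, fun M _ u hu hu0 t => ?_⟩
  set A0 := sobolevNorm 1 (u 0) with hA0
  set A := sobolevNorm 1 (u t) with hA
  have hA00 : 0 ≤ A0 := sobolevNorm_nonneg _ _
  have hAn : 0 ≤ A := sobolevNorm_nonneg _ _
  -- if `A > L A0`, the potential energy is absorbed by the kinetic energy, by the choice of `L`
  rcases le_or_gt A (L * A0) with h | h
  · exact h.trans (mul_le_mul_of_nonneg_right (le_max_left _ _) hA00)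
  refine le_trans ?_ (mul_le_mul_of_nonneg_right (le_max_right L 3) hA00)
  have h1 := sobolevNorm_sq_le (u t)
  have h2 := hu.mass_eq t
  have h3 := hu.energy_eq hp t
  have h4 := mass_add_kinetic_le (u 0)
  have h5 := hS M (u t)
  have h6 : 2 * -1 / (p + 1) = -(2 / (p + 1)) := by ring
  have h6' : 2 / (p + 1) ≤ 1 := by rw [div_le_one (by linarith)]; linarith
  have h7 : 0 ≤ 2 / (p + 1) := div_nonneg (by norm_num) (by linarith)
  have h8 := mul_nonneg h7 (potential_nonneg (p + 1) (u 0))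
  have h9 := mul_le_mul_of_nonneg_right h6' (potential_nonneg (p + 1) (u t))
  rw [h6] at h3
  rw [← hA, show p + 1 - 2 = p - 1 by ring, h2] at h5
  have hAL : A0 ≤ A / L := by rw [le_div_iff₀ hL0, mul_comm]; exact h.le
  have e1 : A ^ (p - 1) * (A ^ 2) ^ η = A ^ θ := by
    rw [← Real.rpow_natCast, ← Real.rpow_mul hAn, ← Real.rpow_add_of_nonneg hAn (by linarith)
      (by rw [hη]; push_cast; linarith)]
    congr 1; rw [hη, hθ]; push_cast; ring
  have e2 : (mass (u 0)) ^ (1 - η) ≤ A0 ^ θ := by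
    calc _ ≤ (A0 ^ 2) ^ (1 - η) :=
          Real.rpow_le_rpow (mass_nonneg _) (mass_le_sobolevNorm_sq _) (by rw [hη]; linarith)
      _ = _ := by
          rw [← Real.rpow_natCast, ← Real.rpow_mul hA00]
          congr 1; rw [hη, hθ]; push_cast; ring
  have e3 : A0 ^ θ ≤ (A / L) ^ (2 - θ) * R ^ (p - 1) := by
    have : A0 ^ θ = A0 ^ (2 - θ) * A0 ^ (p - 1) := by
      rw [← Real.rpow_add_of_nonneg hA00 h2θ.le (by linarith)]
      congr 1; rw [hθ]; ring
    rw [this]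
    exact mul_le_mul (Real.rpow_le_rpow hA00 hAL h2θ.le)
      (Real.rpow_le_rpow hA00 hu0 (by linarith)) (by positivity) (by positivity)
  have e4 : A ^ θ * A0 ^ θ ≤ A ^ 2 * (R ^ (p - 1) / L ^ (2 - θ)) := by
    calc _ ≤ A ^ θ * ((A / L) ^ (2 - θ) * R ^ (p - 1)) := by gcongr
      _ = (A ^ θ * A ^ (2 - θ)) * (R ^ (p - 1) / L ^ (2 - θ)) := by
          rw [Real.div_rpow hAn hL0.le]; ring
      _ = _ := by
          rw [← Real.rpow_add_of_nonneg hAn (by rw [hθ]; linarith) h2θ.le, add_sub_cancel,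
            ← Real.rpow_natCast A 2]
          norm_cast
  have e5 : 3 * C * (R ^ (p - 1) / L ^ (2 - θ)) ≤ 1 / 2 := by
    rw [hLθ, ← mul_div_assoc, div_le_div_iff₀ (by positivity) (by norm_num)]
    linarith
  have e6 : potential (p + 1) (u t) ≤ C * (A ^ 2 * (R ^ (p - 1) / L ^ (2 - θ))) := by
    refine h5.trans (mul_le_mul_of_nonneg_left ?_ hC.le)
    rw [e1]
    exact (mul_le_mul_of_nonneg_left e2 (by positivity)).trans e4
  have e7 : 3 * C * (R ^ (p - 1) / L ^ (2 - θ)) * A ^ 2 ≤ 1 / 2 * A ^ 2 := by gcongr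
  have e8 : A ^ 2 ≤ 6 * A0 ^ 2 := by linarith
  refine abs_le_of_sq_le_sq' ?_ (by positivity) |>.2
  nlinarith [sq_nonneg A0]

/-- The `H¹_h` norm of a solution is bounded for all times, uniformly in the mesh size. -/
lemma exists_sobolevNorm_le {lam p : ℝ} (hp : (lam = 1 ∧ 1 < p) ∨ (lam = -1 ∧ 1 < p ∧ p < 3))
    {R : ℝ} (hR : 0 ≤ R) :
    ∃ C : ℝ, 0 < C ∧ ∀ (M : ℕ) [NeZero M] (u : ℝ → Lattice 2 M → ℂ), IsSolution lam p u →
      sobolevNorm 1 (u 0) ≤ R → ∀ t, sobolevNorm 1 (u t) ≤ C * sobolevNorm 1 (u 0) := by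
  rcases hp with ⟨rfl, hp⟩ | ⟨rfl, hp, hp3⟩
  · exact exists_sobolevNorm_le_defocusing hp hR
  · exact exists_sobolevNorm_le_focusing hp hp3 hR

/-! ### Space-time bounds for solutions -/

lemma supNorm_eq_norm {d M : ℕ} [NeZero M] (f : Lattice d M → ℂ) : supNorm f = ‖f‖ := by
  unfold supNorm
  refine le_antisymm (ciSup_le fun x => norm_le_pi_norm f x) ?_
  refine (pi_norm_le_iff_of_nonneg (Real.iSup_nonneg fun x => norm_nonneg _)).2 fun x => ?_
  exact le_ciSup (f := fun x => ‖f x‖) (Set.finite_range _).bddAbove x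

lemma continuous_piece {M : ℕ} [NeZero M] {u : ℝ → Lattice 2 M → ℂ} (hu : Continuous u) (j : ℕ) :
    Continuous fun t => piece (u t) j :=
  continuous_pi fun _ => continuous_const.mul (continuous_finsetSum _ fun k _ =>
    (continuous_fourier hu k).mul continuous_const)

/-- The a priori inequality behind the theorem: each dyadic piece is bounded in `L^q` by
interpolation between the space-time estimate and Bernstein's inequality, and the pieces are summed
by Jensen's inequality. -/
lemma exists_integral_rpow_le {p q : ℝ} (hp : 1 < p) (hq : 2 ≤ q) :
    ∃ C : ℝ, 0 < C ∧ ∀ (lam : ℝ), |lam| = 1 → ∀ (M : ℕ) [NeZero M] (u : ℝ → Lattice 2 M → ℂ),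
      IsSolution lam p u → ∀ A : ℝ, (∀ t, sobolevNorm 1 (u t) ≤ A) →
      ∫ t in (0 : ℝ)..1, ‖u t‖ ^ q ≤
        C * A ^ q * (1 + ∫ t in (0 : ℝ)..1, ‖u t‖ ^ (2 * p - 2)) := by
  -- `σ = 2^{-1/8}`: half of the gain `σ²` per shell pays for Jensen's inequality
  set σ : ℝ := (2⁻¹ : ℝ) ^ (1 / 8 : ℝ) with hσ
  have hσ0 : 0 < σ := Real.rpow_pos_of_pos (by norm_num) _
  have hσ1 : σ < 1 := Real.rpow_lt_one (by norm_num) (by norm_num) (by norm_num)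
  have hσ8 : σ ^ 8 = 2⁻¹ := by
    rw [hσ, ← Real.rpow_natCast, ← Real.rpow_mul (by norm_num)]; norm_num
  have hρ1 : 1 ≤ (σ ^ 2)⁻¹ := (one_le_inv₀ (by positivity)).2 (pow_le_one₀ hσ0.le hσ1.le)
  have hρ : ((σ ^ 2)⁻¹) ^ 4 = 2 := by rw [inv_pow, ← pow_mul, hσ8, inv_inv]
  obtain ⟨C, hC, hJ⟩ := exists_rpow_sum_le hσ0 hσ1 (by linarith : 1 ≤ q)
  have h1σ : 0 < 1 - σ := by linarith
  refine ⟨C * (5 ^ (q - 2) * 3296 * (3 * (p + 1) ^ 2)) * (1 - σ)⁻¹, by positivity, ?_⟩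
  intro lam hlam M _ u hu A hA
  have hA0 : 0 ≤ A := (sobolevNorm_nonneg 1 (u 0)).trans (hA 0)
  have cu := hu.continuous
  have cnq : ∀ r : ℝ, 0 ≤ r → Continuous fun t => ‖u t‖ ^ r := fun r hr =>
    cu.norm.rpow_const fun _ => Or.inr hr
  have cp : ∀ j, Continuous fun t => ‖piece (u t) j‖ := fun j => (continuous_piece cu j).norm
  set Z := ∫ t in (0 : ℝ)..1, ‖u t‖ ^ (2 * p - 2) with hZ
  have hZ0 : 0 ≤ Z := intervalIntegral.integral_nonneg zero_le_one fun t _ => by positivity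
  have hN : ∫ s in (0 : ℝ)..1, sobolevNorm 1 (fun x => nonlin p (u s x)) ^ 2 ≤
      3 * (p + 1) ^ 2 * A ^ 2 * Z := by
    rw [hZ, ← intervalIntegral.integral_const_mul]
    refine intervalIntegral.integral_mono_on zero_le_one
      ((continuous_sobolevNorm_sq (hu.continuous_nonlin hp)).intervalIntegrable _ _)
      (((cnq _ (by linarith)).const_mul _).intervalIntegrable _ _) fun s _ => ?_
    have := sobolevNorm_nonneg 1 (u s)
    calc _ ≤ _ := sobolevNorm_nonlin_sq_le hp (u s)
      _ ≤ 3 * (p + 1) ^ 2 * ‖u s‖ ^ (2 * p - 2) * A ^ 2 := by gcongr; exact hA s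
      _ = _ := by ring
  have hpc : ∀ j, ∫ t in (0 : ℝ)..1, ‖piece (u t) j‖ ^ q ≤
      5 ^ (q - 2) * 3296 * (3 * (p + 1) ^ 2) * A ^ q * (1 + Z) * (σ ^ 2) ^ j := by
    intro j
    have h1 : ∫ t in (0 : ℝ)..1, ‖piece (u t) j‖ ^ q ≤
        ∫ t in (0 : ℝ)..1, (5 * A) ^ (q - 2) * ‖piece (u t) j‖ ^ 2 := by
      refine intervalIntegral.integral_mono_on zero_le_one
        (((cp j).rpow_const fun _ => Or.inr (by linarith)).intervalIntegrable _ _)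
        ((((cp j).pow 2).const_mul _).intervalIntegrable _ _) fun t _ => ?_
      rw [rpow_eq_rpow_mul_sq (norm_nonneg _) hq]
      refine mul_le_mul_of_nonneg_right (Real.rpow_le_rpow (norm_nonneg _) ?_ (by linarith))
        (sq_nonneg _)
      refine (pi_norm_le_iff_of_nonneg (by positivity)).2 fun x => ?_
      exact (norm_piece_le (u t) j x).trans (by gcongr; exact hA t)
    rw [intervalIntegral.integral_const_mul] at h1
    have h2 := hu.integral_norm_piece_sq_le hρ1 hρ hlam hp j
    have h3 : sobolevNorm 1 (u 0) ^ 2 ≤ 3 * (p + 1) ^ 2 * A ^ 2 := by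
      have h4 : sobolevNorm 1 (u 0) ^ 2 ≤ A ^ 2 := by
        have := sobolevNorm_nonneg 1 (u 0)
        gcongr; exact hA 0
      have h5 : 1 ≤ 3 * (p + 1) ^ 2 := by nlinarith
      linarith [mul_le_mul_of_nonneg_right h5 (sq_nonneg A)]
    have e : (((σ ^ 2)⁻¹) ^ j)⁻¹ = (σ ^ 2) ^ j := by rw [inv_pow, inv_inv]
    rw [e] at h2
    calc _ ≤ _ := h1
      _ ≤ (5 * A) ^ (q - 2) * (3296 * (σ ^ 2) ^ j * (3 * (p + 1) ^ 2 * A ^ 2 +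
          3 * (p + 1) ^ 2 * A ^ 2 * Z)) := by
          refine mul_le_mul_of_nonneg_left (h2.trans ?_) (by positivity)
          gcongr
      _ = _ := by
          rw [Real.mul_rpow (by norm_num) hA0, rpow_eq_rpow_mul_sq hA0 hq]; ring
  set B := 5 ^ (q - 2) * 3296 * (3 * (p + 1) ^ 2) * A ^ q * (1 + Z) with hB
  have hB0 : 0 ≤ B := by positivity
  have cpq : ∀ j, Continuous fun t => (σ⁻¹) ^ j * ‖piece (u t) j‖ ^ q := fun j =>
    continuous_const.mul ((cp j).rpow_const fun _ => Or.inr (by linarith))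
  have hsum : ∫ t in (0 : ℝ)..1, ‖u t‖ ^ q ≤
      ∫ t in (0 : ℝ)..1, C * ∑ j ∈ Finset.range (M + 1), (σ⁻¹) ^ j * ‖piece (u t) j‖ ^ q := by
    refine intervalIntegral.integral_mono_on zero_le_one
      ((cnq q (by linarith)).intervalIntegrable _ _)
      ((continuous_const.mul (continuous_finsetSum _ fun j _ => cpq j)).intervalIntegrable _ _)
      fun t _ => ?_
    refine le_trans ?_ (hJ (M + 1) (fun j => ‖piece (u t) j‖) fun j => norm_nonneg _)
    refine Real.rpow_le_rpow (norm_nonneg _) ?_ (by linarith)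
    have e : u t = ∑ j ∈ Finset.range (M + 1), piece (u t) j := by
      funext x; rw [Finset.sum_apply]; exact sum_piece (u t) x
    conv_lhs => rw [e]
    exact norm_sum_le _ _
  rw [intervalIntegral.integral_const_mul,
    intervalIntegral.integral_finsetSum fun j _ => (cpq j).intervalIntegrable _ _] at hsum
  simp_rw [intervalIntegral.integral_const_mul] at hsum
  calc _ ≤ _ := hsum
    _ ≤ C * ∑ j ∈ Finset.range (M + 1), (σ⁻¹) ^ j * (B * (σ ^ 2) ^ j) :=
        mul_le_mul_of_nonneg_left (Finset.sum_le_sum fun j _ =>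
          mul_le_mul_of_nonneg_left (hpc j) (by positivity)) hC.le
    _ = C * (B * ∑ j ∈ Finset.range (M + 1), σ ^ j) := by
        rw [Finset.mul_sum _ _ B]
        congr 1
        refine Finset.sum_congr rfl fun j _ => ?_
        have : (σ ^ 2) ^ j = σ ^ j * σ ^ j := by ring
        rw [this, inv_pow]
        field_simp
    _ ≤ C * (B * (1 - σ)⁻¹) := by gcongr; exact sum_geometric_le hσ0.le hσ1 _
    _ = _ := by rw [hB]; ring

/-- The `L^q([0,1]; L^∞_h)` norm of a solution is bounded linearly by its `H¹_h` norm. -/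
lemma exists_integral_rpow_le_of_bound {p q : ℝ} (hp : 1 < p) (hq : 2 ≤ q) (D : ℝ) (hD : 0 ≤ D) :
    ∃ C : ℝ, 0 < C ∧ ∀ (lam : ℝ), |lam| = 1 → ∀ (M : ℕ) [NeZero M] (u : ℝ → Lattice 2 M → ℂ),
      IsSolution lam p u → ∀ A : ℝ, A ≤ D → (∀ t, sobolevNorm 1 (u t) ≤ A) →
      ∫ t in (0 : ℝ)..1, ‖u t‖ ^ q ≤ C * A ^ q := by
  obtain ⟨C1, hC1, h1⟩ := exists_integral_rpow_le (q := 2 * p) hp (by linarith)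
  obtain ⟨C2, hC2, h2⟩ := exists_integral_rpow_le hp hq
  set W := C1 * D ^ (2 * p) with hW
  have hW0 : 0 ≤ W := by positivity
  -- with `L² > 2 W`, at most half of `Y` comes back after absorption
  set L := Real.sqrt (2 * W + 1) with hL
  have hL0 : 0 < L := by positivity
  have hL2 : L ^ 2 = 2 * W + 1 := Real.sq_sqrt (by positivity)
  set K := L ^ (2 * p - 2) with hK
  have hK0 : 0 < K := by positivity
  refine ⟨C2 * (1 + (K + 2 * W * (1 + K))), by positivity, ?_⟩
  intro lam hlam M _ u hu A hAD hA
  have hA0 : 0 ≤ A := (sobolevNorm_nonneg 1 (u 0)).trans (hA 0)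
  have cn : ∀ r : ℝ, 0 ≤ r → Continuous fun t => ‖u t‖ ^ r := fun r hr =>
    hu.continuous.norm.rpow_const fun _ => Or.inr hr
  set Y := ∫ t in (0 : ℝ)..1, ‖u t‖ ^ (2 * p) with hY
  set Z := ∫ t in (0 : ℝ)..1, ‖u t‖ ^ (2 * p - 2) with hZ
  have hY0 : 0 ≤ Y := intervalIntegral.integral_nonneg zero_le_one fun t _ => by positivity
  have hZ0 : 0 ≤ Z := intervalIntegral.integral_nonneg zero_le_one fun t _ => by positivity
  -- absorption: `s^(2p-2) ≤ L^(2p-2) + s^(2p) / L²`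
  have hZY : Z ≤ K + Y / L ^ 2 := by
    have e : K + Y / L ^ 2 = ∫ t in (0 : ℝ)..1, (K + ‖u t‖ ^ (2 * p) / L ^ 2) := by
      rw [intervalIntegral.integral_add (by simp)
        (((cn _ (by linarith)).div_const _).intervalIntegrable _ _), intervalIntegral.integral_div]
      simp [hY]
    rw [e]
    refine intervalIntegral.integral_mono_on zero_le_one
      ((cn _ (by linarith)).intervalIntegrable _ _)
      ((continuous_const.add ((cn _ (by linarith)).div_const _)).intervalIntegrable _ _)
      fun t _ => ?_
    set s := ‖u t‖ with hs
    have hs0 : 0 ≤ s := norm_nonneg _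
    rcases le_total s L with h | h
    · have : s ^ (2 * p - 2) ≤ K := Real.rpow_le_rpow hs0 h (by linarith)
      have : 0 ≤ s ^ (2 * p) / L ^ 2 := by positivity
      linarith
    · have e : s ^ (2 * p) = s ^ (2 * p - 2) * s ^ 2 := rpow_eq_rpow_mul_sq hs0 (by linarith)
      have : s ^ (2 * p - 2) ≤ s ^ (2 * p) / L ^ 2 := by
        rw [le_div_iff₀ (by positivity), e]; gcongr
      linarith
  have hYW : Y ≤ W * (1 + Z) := by
    refine (h1 lam hlam M u hu A hA).trans ?_
    rw [hW]
    have : A ^ (2 * p) ≤ D ^ (2 * p) := Real.rpow_le_rpow hA0 hAD (by linarith)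
    gcongr
  have hY' : Y ≤ 2 * W * (1 + K) := by
    have h3 : W * (Y / L ^ 2) ≤ Y / 2 := by
      rw [hL2, ← mul_div_assoc, div_le_div_iff₀ (by positivity) (by norm_num)]
      linarith
    have h4 := mul_le_mul_of_nonneg_left hZY hW0
    linarith
  have hZ' : Z ≤ K + 2 * W * (1 + K) := by
    have h5 : Y / L ^ 2 ≤ Y := div_le_self hY0 (by rw [hL2]; linarith)
    linarith
  refine (h2 lam hlam M u hu A hA).trans ?_
  have hAq : 0 ≤ A ^ q := by positivity
  calc C2 * A ^ q * (1 + Z) ≤ C2 * A ^ q * (1 + (K + 2 * W * (1 + K))) := by gcongr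
    _ = _ := by ring

lemma IsSolution.comp_add {d M : ℕ} {lam p : ℝ} {u : ℝ → Lattice d M → ℂ}
    (hu : IsSolution lam p u) (a : ℝ) : IsSolution lam p fun t => u (t + a) := by
  intro t x
  obtain ⟨h1, h2⟩ := hu (t + a) x
  have h := h1.hasDerivAt.comp_add_const t a
  refine ⟨h.differentiableAt, ?_⟩
  rw [h.deriv]
  exact h2

/-- Covering `[-T, T]` by translates of the unit interval. -/
lemma integral_symm_le {φ : ℝ → ℝ} (hφ : Continuous φ) (h0 : ∀ t, 0 ≤ φ t) {B : ℝ}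
    (hB : ∀ a, ∫ t in (0 : ℝ)..1, φ (t + a) ≤ B) {T : ℝ} (hT : 0 < T) :
    ∫ t in (-T)..T, φ t ≤ 4 * bracket T * B := by
  have hB0 : 0 ≤ B := (intervalIntegral.integral_nonneg zero_le_one fun t _ => h0 (t + 0)).trans (hB 0)
  set n := ⌈T⌉₊ with hn
  have hTn : T ≤ n := Nat.le_ceil T
  have hb : T ≤ bracket T ∧ 1 ≤ bracket T := by
    unfold bracket
    constructor
    · exact Real.le_sqrt_of_sq_le (by linarith)
    · exact Real.one_le_sqrt.2 (by nlinarith)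
  have hnT : (n : ℝ) ≤ 2 * bracket T := by
    have := Nat.ceil_lt_add_one hT.le
    linarith [hb.1, hb.2]
  have hi : ∀ a b, IntervalIntegrable φ MeasureTheory.volume a b := fun a b =>
    hφ.intervalIntegrable a b
  have h1 : ∫ t in (-T)..T, φ t ≤ ∫ t in (-(n : ℝ))..n, φ t :=
    intervalIntegral.integral_mono_interval (by linarith) (by linarith) hTn
      (Filter.Eventually.of_forall h0) (hi _ _)
  have h2 : ∑ i ∈ Finset.range (2 * n), ∫ t in (-(n : ℝ) + (i : ℕ))..(-(n : ℝ) + ((i + 1 : ℕ) : ℝ)), φ t =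
      ∫ t in (-(n : ℝ))..n, φ t := by
    rw [intervalIntegral.sum_integral_adjacent_intervals (a := fun i : ℕ => -(n : ℝ) + i)
      fun i _ => hi _ _]
    congr 1
    · simp
    · push_cast; ring
  have h3 : ∀ i : ℕ, ∫ t in (-(n : ℝ) + (i : ℕ))..(-(n : ℝ) + ((i + 1 : ℕ) : ℝ)), φ t ≤ B := by
    intro i
    have := hB (-(n : ℝ) + i)
    rw [intervalIntegral.integral_comp_add_right] at this
    refine le_trans (le_of_eq ?_) this
    congr 1 <;> push_cast <;> ring
  calc _ ≤ _ := h1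
    _ = _ := h2.symm
    _ ≤ ∑ i ∈ Finset.range (2 * n), B := Finset.sum_le_sum fun i _ => h3 i
    _ = 2 * n * B := by simp
    _ ≤ 2 * (2 * bracket T) * B := by gcongr
    _ = _ := by ring

end DNLS

theorem proposition4p2 (lam p q : ℝ)
    (hp : (lam = 1 ∧ 1 < p) ∨ (lam = -1 ∧ 1 < p ∧ p < 3))
    (hq : (p < 3 ∧ q = 2) ∨ (3 ≤ p ∧ p - 1 < q))
    (R : ℝ) :
    ∃ C : ℝ, 0 < C ∧
      ∀ (M : ℕ) [NeZero M], DNLS.meshSize M ≤ 1 →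
      ∀ u₀ : DNLS.Lattice 2 M → ℂ, DNLS.sobolevNorm 1 u₀ ≤ R →
      ∀ u : ℝ → DNLS.Lattice 2 M → ℂ, DNLS.IsSolution lam p u → u 0 = u₀ →
      ∀ T : ℝ, 0 < T →
        DNLS.timeSupNorm q T u ≤
          ENNReal.ofReal (C * DNLS.bracket T ^ (1 / q) * DNLS.sobolevNorm 1 u₀) := by
  have hq2 : 2 ≤ q := by rcases hq with ⟨-, rfl⟩ | ⟨h1, h2⟩ <;> linarith
  have hq0 : 0 < q := by linarith
  have hp1 : 1 < p := by rcases hp with h | h <;> linarith [h.2]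
  have hlam : |lam| = 1 := by rcases hp with ⟨rfl, -⟩ | ⟨rfl, -⟩ <;> norm_num
  obtain ⟨C1, hC1, h1⟩ := DNLS.exists_sobolevNorm_le hp (abs_nonneg R)
  obtain ⟨C2, hC2, h2⟩ := DNLS.exists_integral_rpow_le_of_bound hp1 hq2 (C1 * |R|) (by positivity)
  refine ⟨(4 * C2) ^ (1 / q) * C1, by positivity, ?_⟩
  intro M _ _ u₀ hu0 u hu huu T hT
  subst huu
  set A0 := DNLS.sobolevNorm 1 (u 0) with hA0
  have hA00 : 0 ≤ A0 := DNLS.sobolevNorm_nonneg _ _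
  have hR : A0 ≤ |R| := hu0.trans (le_abs_self R)
  have hbd := h1 M u hu hR
  have cu := hu.continuous
  have cq : Continuous fun t => ‖u t‖ ^ q := cu.norm.rpow_const fun _ => Or.inr hq0.le
  have hbr : 0 ≤ DNLS.bracket T := Real.sqrt_nonneg _
  have hint : ∫ t in (-T)..T, ‖u t‖ ^ q ≤ 4 * DNLS.bracket T * (C2 * (C1 * A0) ^ q) := by
    refine DNLS.integral_symm_le cq (fun t => by positivity) (fun a => ?_) hT
    exact h2 lam hlam M (fun t => u (t + a)) (hu.comp_add a) (C1 * A0) (by gcongr)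
      fun t => hbd (t + a)
  unfold DNLS.timeSupNorm
  have e : (fun t => DNLS.supNorm (u t)) = fun t => ‖u t‖ := by
    funext t; exact DNLS.supNorm_eq_norm _
  rw [e]
  have hmem : MeasureTheory.MemLp (fun t => ‖u t‖) (ENNReal.ofReal q)
      (MeasureTheory.volume.restrict (Set.Icc (-T) T)) := by
    refine (MeasureTheory.integrable_norm_rpow_iff cu.norm.aestronglyMeasurable
      (by simpa using hq0) ENNReal.ofReal_ne_top).1 ?_
    rw [ENNReal.toReal_ofReal hq0.le]
    simp only [norm_norm]
    exact cq.continuousOn.integrableOn_compact isCompact_Icc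
  rw [hmem.eLpNorm_eq_integral_rpow_norm (by simpa using hq0) ENNReal.ofReal_ne_top,
    ENNReal.toReal_ofReal hq0.le]
  refine ENNReal.ofReal_le_ofReal ?_
  simp only [norm_norm]
  rw [MeasureTheory.integral_Icc_eq_integral_Ioc,
    ← intervalIntegral.integral_of_le (by linarith : -T ≤ T)]
  calc _ ≤ (4 * DNLS.bracket T * (C2 * (C1 * A0) ^ q)) ^ q⁻¹ :=
        Real.rpow_le_rpow (intervalIntegral.integral_nonneg (by linarith) fun t _ => by positivity)
          hint (by positivity)
    _ = _ := by
        have e2 : 4 * DNLS.bracket T * (C2 * (C1 * A0) ^ q) =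
          (4 * C2) * DNLS.bracket T * (C1 * A0) ^ q := by ring
        rw [e2, Real.mul_rpow (by positivity) (by positivity),
          Real.mul_rpow (by positivity) hbr, ← Real.rpow_mul (by positivity),
          mul_inv_cancel₀ hq0.ne', Real.rpow_one, one_div]
        ring
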